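/- Let $(\{0,1\},W_{Z|X},\mathcal Z)$ be a discrete memoryless channel with finite output alphabet, $Q_x:=W_{Z|X=x}$ for $x\in\{0,1\}$, and $Q_1\ll Q_0$. For positive integers $\ell\le n$ put $m:=\lfloor n/\ell\rfloor$, let $\mathcal B_i:=\{(i-1)m+1,\dots,im\}$ for $1\le i\le\ell$ and $\mathcal B_{\ell+1}:=\{\ell m+1,\dots,n\}$, and let $P^{n,\ell}_{\mathbf Z,\mathrm{PPM}}$ be the distribution on $\mathcal Z^n$ of the output of $n$ uses of the channel when the input is uniformly distributed on the sequences $\mathbf x\in\{0,1\}^n$ with exactly one $1$ in each $\mathcal B_i$, $1\le i\le\ell$, and no $1$ in $\mathcal B_{\ell+1}$. Write $\log$ for the natural logarithm, $D(P\|R):=\sum_x P(x)\log\frac{P(x)}{R(x)}$, $V(P,R):=\frac12\sum_x|P(x)-R(x)|$, $\chi_2(P\|R):=\sum_x\frac{(P(x)-R(x))^2}{R(x)}$ (with the usual convention that terms $0/0$ and $0\log\frac{0}{\cdot}$ are $0$), $\beta_\alpha(P,R):=\inf\{R(T):P(T^c)\le\alpha\}$, where $T$ ranges over subsets of the alphabet,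 and $Q(x):=\int_x^\infty\frac{1}{\sqrt{2\pi}}e^{-t^2/2}\,dt$ for real $x$, with inverse $Q^{-1}:(0,1)\to\mathbb R$. Abbreviate $\chi_2:=\chi_2(Q_1\|Q_0)$. Fix $0<c_1,c_2<\infty$. All claims below are for all positive integers $n,\ell$ with $m=\lfloor n/\ell\rfloor\ge m_0$ and $c_1m\le\ell\le c_2m$ (that is, $\ell=\Theta(m)$ and $m$ is large enough). (i) There are constants $K$ and $m_0$, depending only on $Q_0,Q_1,c_1,c_2$, such that $$D\big(P^{n,\ell}_{\mathbf Z,\mathrm{PPM}}\,\big\|\,Q_0^{\otimes n}\big)\le\frac{\ell^2}{2n}\chi_2+\frac{K}{\sqrt n}.$$ (ii) If in addition $Q_0\ll Q_1$, there are constants $K$ and $m_0$, depending only on $Q_0,Q_1,c_1,c_2$, such that $$V\big(P^{n,\ell}_{\mathbf Z,\mathrm{PPM}},Q_0^{\otimes n}\big)\le1-2Q\Big(\frac{\ell}{2}\sqrt{\frac{\chi_2}{n}}\Big)+\frac{2}{\sqrt\ell}+\frac{K}{\sqrt n}.$$ (iii) If in addition $Q_0\ll Q_1$, then for every $\alpha\in[0,1)$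 there are constants $K$ and $m_0$, depending only on $Q_0,Q_1,c_1,c_2,\alpha$, such that $\alpha+\frac1{\sqrt\ell}<1$ and $$\beta_\alpha\big(Q_0^{\otimes n},P^{n,\ell}_{\mathbf Z,\mathrm{PPM}}\big)\ge Q\Big(\ell\sqrt{\frac{\chi_2}{n}}-Q^{-1}\Big(\alpha+\frac1{\sqrt\ell}\Big)\Big)-\frac1{\sqrt\ell}-\frac{K}{\sqrt n}.$$ -/

import Mathlib

open scoped BigOperators

namespace Covert

noncomputable section

/-- A discrete memoryless channel: input alphabet `X`, finite output alphabet `Z`,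
transition probabilities `prob x z` (probability of output `z` on input `x`). -/
structure DMC (X Z : Type*) [Fintype Z] where
  prob : X → Z → ℝ
  prob_nonneg : ∀ x z, 0 ≤ prob x z
  prob_sum : ∀ x, ∑ z, prob x z = 1

/-- Absolute continuity `P ≪ Q` of mass functions. -/
def AbsCont {Ω : Type*} (P Q : Ω → ℝ) : Prop := ∀ x, Q x = 0 → P x = 0

/-- Relative entropy in nats, for `P ≪ Q`. -/
def relEntropy {Ω : Type*} [Fintype Ω] (P Q : Ω → ℝ) : ℝ :=
  ∑ x, P x * Real.log (P x / Q x)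

/-- Variational distance. -/
def varDist {Ω : Type*} [Fintype Ω] (P Q : Ω → ℝ) : ℝ :=
  (1 / 2) * ∑ x, |P x - Q x|

/-- Chi-squared distance, for `P ≪ Q`. -/
def chiSq {Ω : Type*} [Fintype Ω] (P Q : Ω → ℝ) : ℝ :=
  ∑ x, (P x - Q x) ^ 2 / Q x

/-- Optimal probability of missed detection: the infimum of `Q(T)` over the sets `T`
with `P(Tᶜ) ≤ α`. -/
def betaErr {Ω : Type*} [Fintype Ω] [DecidableEq Ω] (α : ℝ) (P Q : Ω → ℝ) : ℝ :=
  sInf {b : ℝ | ∃ T : Finset Ω, ∑ x ∈ Tᶜ, P x ≤ α ∧ b = ∑ x ∈ T, Q x}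

/-- The product distribution `P^{⊗ n}`. -/
def prodDist {Ω : Type*} (P : Ω → ℝ) (n : ℕ) (z : Fin n → Ω) : ℝ :=
  ∏ i, P (z i)

/-- Gaussian tail function. -/
def gaussQ (x : ℝ) : ℝ :=
  ∫ t in Set.Ioi x, 1 / Real.sqrt (2 * Real.pi) * Real.exp (-t ^ 2 / 2)

/-- Inverse of the Gaussian tail function: for `p ∈ (0, 1)` it is the
(unique) `x` with `gaussQ x = p`. -/
def gaussQInv : ℝ → ℝ := Function.invFun gaussQ

/-- With `m = n / ℓ` (integer division), the block number `i` of positions, `i = 0, …, ℓ - 1`. -/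
def ppmBlock (n ℓ i : ℕ) : Finset (Fin n) :=
  Finset.univ.filter fun j => i * (n / ℓ) ≤ (j : ℕ) ∧ (j : ℕ) < (i + 1) * (n / ℓ)

/-- The leftover positions after the `ℓ` blocks. -/
def ppmRest (n ℓ : ℕ) : Finset (Fin n) :=
  Finset.univ.filter fun j => ℓ * (n / ℓ) ≤ (j : ℕ)

/-- Binary sequences with exactly one `1` in each of the `ℓ` blocks and none in the rest. -/
def ppmSupport (n ℓ : ℕ) : Finset (Fin n → Fin 2) :=
  Finset.univ.filter fun x =>
    (∀ i < ℓ, ∑ j ∈ ppmBlock n ℓ i, (x j : ℕ) = 1) ∧ ∑ j ∈ ppmRest n ℓ, (x j : ℕ) = 0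

/-- The `(n, ℓ)`-PPM input distribution: uniform on `ppmSupport n ℓ`. -/
def ppmInput (n ℓ : ℕ) (x : Fin n → Fin 2) : ℝ :=
  if x ∈ ppmSupport n ℓ then 1 / ((ppmSupport n ℓ).card : ℝ) else 0

/-- The output distribution of the `(n, ℓ)`-PPM input distribution through `n` uses of the
memoryless channel `W`. -/
def ppmOutput {Z : Type*} [Fintype Z] (W : DMC (Fin 2) Z) (n ℓ : ℕ) (z : Fin n → Z) : ℝ :=
  ∑ x : Fin n → Fin 2, ppmInput n ℓ x * ∏ i, W.prob (x i) (z i)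

end

end Covert

open Covert

/-!
Let `w = dQ₁ / dQ₀`. The likelihood ratio of the PPM output with respect to `Q₀^{⊗ n}` is a product
`Λ = A₁ ⋯ A_ℓ` of block means `A = (1 / m) ∑ w(z_j)` (`ppmOutput_eq`), which under `Q₀^{⊗ n}` are
independent and identically distributed (`sum_prodDist_blocks`). Write `A = 1 + s`. Then `E s = 0`,
`E s² = χ₂ / m`, and both `E s³` and `E s⁴` are `O(m⁻²)` (`exists_block_moments`).

The relative entropy is `ℓ E[A log A]`, and `A log A ≤ s + s² / 2 - s³ / 6 + s⁴ / 3`; taking means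
gives `ℓ χ₂ / (2 m) + O(ℓ / m²)` (`relEntropy_ppmOutput_le`).

The other two claims are about the hockey-stick divergences `E (γ - Λ)⁺`: the variational distance
is the case `γ = 1` (`varDist_le_sum_max`), and `β_α ≥ γ (1 - α) - E (γ - Λ)⁺` for every `γ > 0`
(`le_betaErr`). No Berry–Esseen theorem is used. Since `A` has mean one, `E (γ - Λ)⁺` is the price
of a put with strike `γ` in a discrete-time market, and it is compared with the Black–Scholes
price `u(t, x)` at total variance `t` and spot `x` (`bsPut`). It satisfies
`∂ₜ u = x² ∂ₓ² u / 2`, so a fourth-order Taylor expansion gives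
`E u(t, x A) ≤ u(t + τ, x) + O(x m⁻² t ^ (-3/2))` with `τ = χ₂ / m` (`sum_bsPut_mul_le`). The
expansion needs `A` bounded away from `0`, which is where `Q₀ ≪ Q₁` enters. The
iteration starts from `(γ - x)⁺ ≤ u(ε, x)`, which avoids the singularity of the derivatives at
`t = 0`. The errors telescope to `O(m⁻¹ ε ^ (-1/2))`, and the shift of the final time by `ε` costs
`O(ε)`. With `ε` of order `m ^ (-2/3)` the total is of smaller order than `1 / √ℓ`
(`exists_sum_max_sub_ppmOutput_le`), uniformly in `γ`. Evaluating `u` at time `ℓ² χ₂ / n` and spot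
`1` gives the Gaussian expressions, with `γ` the likelihood-ratio threshold that is optimal for the
Gaussian problem.
-/


namespace Covert

open Filter Topology MeasureTheory

/-! ### Product distributions -/

theorem prodDist_nonneg {Y : Type*} {q : Y → ℝ} (hq : ∀ y, 0 ≤ q y) (n : ℕ) (y : Fin n → Y) :
    0 ≤ prodDist q n y :=
  Finset.prod_nonneg fun i _ => hq (y i)

/-- Conditioning on the first coordinate of an i.i.d. sequence. -/
theorem sum_prodDist_succ {Y : Type*} [Fintype Y] (q : Y → ℝ) (n : ℕ) (F : (Fin (n + 1) → Y) → ℝ) :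
    ∑ y, prodDist q (n + 1) y * F y =
      ∑ a, q a * ∑ y, prodDist q n y * F (Fin.cons a y) := by
  rw [← (Fin.consEquiv fun _ : Fin (n + 1) => Y).sum_comp, Fintype.sum_prod_type]
  refine Finset.sum_congr rfl fun a _ => ?_
  rw [Finset.mul_sum]
  refine Finset.sum_congr rfl fun y _ => ?_
  simp [prodDist, Fin.consEquiv, Fin.prod_univ_succ, mul_assoc]

theorem sum_prodDist {Y : Type*} [Fintype Y] {q : Y → ℝ} (hq : ∑ y, q y = 1) (n : ℕ) :
    ∑ y, prodDist q n y = 1 := by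
  induction n with
  | zero => simp [prodDist]
  | succ n ih =>
    have := sum_prodDist_succ q n fun _ => 1
    simpa [ih, hq] using this

/-- If `G (k + 1) x` dominates the mean of `G k (x * A)` for each `k`, then `G ℓ x` dominates the
mean of `G 0` at `x` times a product of `ℓ` independent copies of `A`.  The one-step bound is only
needed on a set `D` stable under multiplication by the values of `A`. -/
theorem sum_prodDist_le_of_step {Y : Type*} [Fintype Y] {q A : Y → ℝ} (hq : ∀ y, 0 ≤ q y)
    (D : Set ℝ) (hD : ∀ x ∈ D, ∀ y, x * A y ∈ D) (G : ℕ → ℝ → ℝ) (N : ℕ)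
    (hstep : ∀ k < N, ∀ x ∈ D, ∑ y, q y * G k (x * A y) ≤ G (k + 1) x)
    (ℓ : ℕ) (hℓ : ℓ ≤ N) {x : ℝ} (hx : x ∈ D) :
    ∑ y, prodDist q ℓ y * G 0 (x * ∏ i, A (y i)) ≤ G ℓ x := by
  induction ℓ generalizing x with
  | zero => simp [prodDist]
  | succ ℓ ih =>
    rw [sum_prodDist_succ]
    refine le_trans (Finset.sum_le_sum fun a _ => mul_le_mul_of_nonneg_left ?_ (hq a))
      (hstep ℓ hℓ x hx)
    have := ih (Nat.le_of_succ_le hℓ) (hD x hx a)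
    simpa [Fin.prod_univ_succ, mul_assoc] using this

/-! ### Block structure of the PPM output -/

/-- The positions `Fin n` split into `ℓ` blocks of length `n / ℓ` and a remainder. -/
def blockEquiv (n ℓ : ℕ) : (Fin ℓ × Fin (n / ℓ)) ⊕ Fin (n % ℓ) ≃ Fin n :=
  ((finProdFinEquiv.sumCongr (Equiv.refl _)).trans finSumFinEquiv).trans
    (finCongr (Nat.div_add_mod n ℓ))

theorem blockEquiv_inl_val (n ℓ : ℕ) (i : Fin ℓ) (j : Fin (n / ℓ)) :
    (blockEquiv n ℓ (Sum.inl (i, j)) : ℕ) = j + n / ℓ * i := by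
  simp [blockEquiv]

theorem blockEquiv_inr_val (n ℓ : ℕ) (j : Fin (n % ℓ)) :
    (blockEquiv n ℓ (Sum.inr j) : ℕ) = ℓ * (n / ℓ) + j := by
  simp [blockEquiv]

theorem blockEquiv_inl_mem_ppmBlock {n ℓ : ℕ} (i i' : Fin ℓ) (j : Fin (n / ℓ)) :
    blockEquiv n ℓ (Sum.inl (i, j)) ∈ ppmBlock n ℓ i' ↔ i = i' := by
  simp only [ppmBlock, Finset.mem_filter, Finset.mem_univ, true_and, blockEquiv_inl_val]
  have hj := j.2
  constructor
  · rintro ⟨h1, h2⟩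
    ext
    by_contra hne
    rcases lt_or_gt_of_ne hne with h | h
    · have := Nat.mul_le_mul_right (n / ℓ) (Nat.succ_le_of_lt h)
      rw [Nat.succ_mul] at this
      nlinarith
    · have := Nat.mul_le_mul_right (n / ℓ) (Nat.succ_le_of_lt h)
      rw [Nat.succ_mul] at this
      nlinarith
  · rintro rfl
    constructor <;> nlinarith

theorem blockEquiv_inr_notMem_ppmBlock {n ℓ : ℕ} (i : Fin ℓ) (j : Fin (n % ℓ)) :
    blockEquiv n ℓ (Sum.inr j) ∉ ppmBlock n ℓ i := by
  simp only [ppmBlock, Finset.mem_filter, Finset.mem_univ, true_and, blockEquiv_inr_val, not_and,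
    not_lt]
  intro _
  have := Nat.mul_le_mul_right (n / ℓ) (Nat.succ_le_of_lt i.2)
  rw [Nat.succ_eq_add_one] at this
  omega

theorem sum_ppmBlock {M : Type*} [AddCommMonoid M] {n ℓ : ℕ} (i : Fin ℓ) (g : Fin n → M) :
    ∑ p ∈ ppmBlock n ℓ i, g p = ∑ j, g (blockEquiv n ℓ (Sum.inl (i, j))) := by
  classical
  rw [← Finset.univ_inter (ppmBlock n ℓ i), ← Finset.sum_ite_mem, ← (blockEquiv n ℓ).sum_comp,
    Fintype.sum_sum_type, Fintype.sum_prod_type]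
  simp [blockEquiv_inl_mem_ppmBlock, blockEquiv_inr_notMem_ppmBlock,
    Finset.sum_ite_irrel]

theorem sum_ppmRest {M : Type*} [AddCommMonoid M] {n ℓ : ℕ} (g : Fin n → M) :
    ∑ p ∈ ppmRest n ℓ, g p = ∑ j, g (blockEquiv n ℓ (Sum.inr j)) := by
  classical
  have hl : ∀ (i : Fin ℓ) (j : Fin (n / ℓ)), blockEquiv n ℓ (Sum.inl (i, j)) ∉ ppmRest n ℓ := by
    intro i j
    simp only [ppmRest, Finset.mem_filter, Finset.mem_univ, true_and, blockEquiv_inl_val, not_le]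
    have h1 := j.2
    have h2 := Nat.mul_le_mul_right (n / ℓ) (Nat.succ_le_of_lt i.2)
    rw [Nat.succ_mul] at h2
    nlinarith
  have hr : ∀ j : Fin (n % ℓ), blockEquiv n ℓ (Sum.inr j) ∈ ppmRest n ℓ := by
    intro j
    simp [ppmRest, blockEquiv_inr_val]
  rw [← Finset.univ_inter (ppmRest n ℓ), ← Finset.sum_ite_mem, ← (blockEquiv n ℓ).sum_comp,
    Fintype.sum_sum_type, Fintype.sum_prod_type]
  simp [hl, hr]

/-- The PPM codeword whose `1` in block `i` is at the position `c i` of that block. -/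
def ppmWord (n ℓ : ℕ) (c : Fin ℓ → Fin (n / ℓ)) (p : Fin n) : Fin 2 :=
  Sum.elim (fun ij => if c ij.1 = ij.2 then 1 else 0) (fun _ => 0) ((blockEquiv n ℓ).symm p)

theorem ppmWord_inl {n ℓ : ℕ} (c : Fin ℓ → Fin (n / ℓ)) (i : Fin ℓ) (j : Fin (n / ℓ)) :
    ppmWord n ℓ c (blockEquiv n ℓ (Sum.inl (i, j))) = if c i = j then 1 else 0 := by
  simp [ppmWord]

theorem ppmWord_inr {n ℓ : ℕ} (c : Fin ℓ → Fin (n / ℓ)) (j : Fin (n % ℓ)) :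
    ppmWord n ℓ c (blockEquiv n ℓ (Sum.inr j)) = 0 := by
  simp [ppmWord]

theorem ppmWord_mem_ppmSupport {n ℓ : ℕ} (c : Fin ℓ → Fin (n / ℓ)) :
    ppmWord n ℓ c ∈ ppmSupport n ℓ := by
  simp only [ppmSupport, Finset.mem_filter, Finset.mem_univ, true_and]
  constructor
  · intro i hi
    have := sum_ppmBlock (n := n) ⟨i, hi⟩ fun p => (ppmWord n ℓ c p : ℕ)
    simp only at this
    rw [this]
    simp [ppmWord_inl, apply_ite Fin.val]
  · rw [sum_ppmRest]
    simp [ppmWord_inr]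

theorem ppmWord_injective (n ℓ : ℕ) : Function.Injective (ppmWord n ℓ) := by
  intro c c' h
  ext1 i
  have := congrFun h (blockEquiv n ℓ (Sum.inl (i, c i)))
  by_contra hne
  simp [ppmWord_inl, Ne.symm hne] at this

theorem exists_ppmWord_eq {n ℓ : ℕ} {x : Fin n → Fin 2} (hx : x ∈ ppmSupport n ℓ) :
    ∃ c, ppmWord n ℓ c = x := by
  simp only [ppmSupport, Finset.mem_filter, Finset.mem_univ, true_and] at hx
  obtain ⟨h1, h2⟩ := hx
  have key : ∀ i : Fin ℓ, ∃ j : Fin (n / ℓ), ∀ j',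
      x (blockEquiv n ℓ (Sum.inl (i, j'))) = if j = j' then 1 else 0 := by
    intro i
    have h := h1 i i.2
    rw [sum_ppmBlock] at h
    obtain ⟨j, -, hj0⟩ := Finset.exists_ne_zero_of_sum_ne_zero (h.trans_ne one_ne_zero)
    rw [← Finset.add_sum_erase _ _ (Finset.mem_univ j)] at h
    have hj : (x (blockEquiv n ℓ (Sum.inl (i, j))) : ℕ) = 1 := by omega
    have hj' := Finset.sum_eq_zero_iff.1 (show ∑ j' ∈ Finset.univ.erase j,
      (x (blockEquiv n ℓ (Sum.inl (i, j'))) : ℕ) = 0 by omega)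
    refine ⟨j, fun j' => ?_⟩
    split_ifs with hjj
    · subst hjj
      exact Fin.ext hj
    · exact Fin.ext (hj' j' (Finset.mem_erase.2 ⟨Ne.symm hjj, Finset.mem_univ _⟩))
  choose c hc using key
  refine ⟨c, ?_⟩
  rw [sum_ppmRest, Finset.sum_eq_zero_iff] at h2
  ext1 p
  obtain ⟨s, rfl⟩ := (blockEquiv n ℓ).surjective p
  rcases s with ⟨i, j⟩ | j
  · rw [ppmWord_inl, hc]
  · rw [ppmWord_inr]
    exact (Fin.ext (h2 j (Finset.mem_univ _))).symm

theorem sum_ppmSupport {n ℓ : ℕ} (F : (Fin n → Fin 2) → ℝ) :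
    ∑ x ∈ ppmSupport n ℓ, F x = ∑ c, F (ppmWord n ℓ c) := by
  symm
  refine Finset.sum_nbij (ppmWord n ℓ) (fun c _ => ppmWord_mem_ppmSupport c)
    (ppmWord_injective n ℓ).injOn (fun x hx => ?_) fun _ _ => rfl
  obtain ⟨c, rfl⟩ := exists_ppmWord_eq hx
  exact ⟨c, by simp, rfl⟩

theorem card_ppmSupport (n ℓ : ℕ) : ((ppmSupport n ℓ).card : ℝ) = ((n / ℓ : ℕ) : ℝ) ^ ℓ := by
  have := sum_ppmSupport (n := n) (ℓ := ℓ) fun _ => 1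
  simpa using this

/-- The likelihood ratio of a PPM output: a product over the blocks of the mean over the block of
the single-letter likelihood ratio `w`. -/
theorem ppmOutput_eq {Z : Type*} [Fintype Z] (W : DMC (Fin 2) Z) {w : Z → ℝ}
    (hw : ∀ z, W.prob 1 z = W.prob 0 z * w z) (n ℓ : ℕ) (z : Fin n → Z) :
    ppmOutput W n ℓ z = prodDist (W.prob 0) n z *
      ∏ i : Fin ℓ, ((∑ j, w (z (blockEquiv n ℓ (Sum.inl (i, j))))) / (n / ℓ : ℕ)) := by
  have h1 : ∀ c : Fin ℓ → Fin (n / ℓ), ∏ p, W.prob (ppmWord n ℓ c p) (z p) =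
      prodDist (W.prob 0) n z * ∏ i, w (z (blockEquiv n ℓ (Sum.inl (i, c i)))) := by
    intro c
    have h2 : ∀ p, W.prob (ppmWord n ℓ c p) (z p) =
        W.prob 0 (z p) * if ppmWord n ℓ c p = 1 then w (z p) else 1 := by
      intro p
      split_ifs with h
      · rw [h, hw]
      · have h0 : ppmWord n ℓ c p = 0 := by
          generalize ppmWord n ℓ c p = a at *
          fin_cases a <;> simp_all
        rw [h0, mul_one]
    simp_rw [h2, Finset.prod_mul_distrib]
    congr 1
    rw [← (blockEquiv n ℓ).prod_comp, Fintype.prod_sum_type, Fintype.prod_prod_type]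
    simp [ppmWord_inl, ppmWord_inr]
  unfold ppmOutput ppmInput
  simp_rw [ite_mul, zero_mul]
  rw [Finset.sum_ite_mem, Finset.univ_inter, sum_ppmSupport]
  simp_rw [h1]
  rw [Finset.prod_div_distrib, Finset.prod_univ_sum, Fintype.piFinset_univ, card_ppmSupport,
    ← Finset.mul_sum, ← Finset.mul_sum]
  simp
  ring

/-- Under a product distribution the blocks are independent copies of one block. -/
theorem sum_prodDist_blocks {Z : Type*} [Fintype Z] {q : Z → ℝ} (hq : ∑ z, q z = 1) (n ℓ : ℕ)
    (F : (Fin ℓ → Fin (n / ℓ) → Z) → ℝ) :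
    ∑ z, prodDist q n z * F (fun i j => z (blockEquiv n ℓ (Sum.inl (i, j)))) =
      ∑ y, prodDist (prodDist q (n / ℓ)) ℓ y * F y := by
  let e : (Fin n → Z) ≃ (Fin ℓ → Fin (n / ℓ) → Z) × (Fin (n % ℓ) → Z) :=
    (((blockEquiv n ℓ).symm.arrowCongr (Equiv.refl Z)).trans
      (Equiv.sumArrowEquivProdArrow _ _ _)).trans
      ((Equiv.curry _ _ _).prodCongr (Equiv.refl _))
  have he : ∀ z : Fin n → Z, e z = (fun i j => z (blockEquiv n ℓ (Sum.inl (i, j))),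
      fun j => z (blockEquiv n ℓ (Sum.inr j))) := fun z => rfl
  have hp : ∀ z : Fin n → Z, prodDist q n z =
      prodDist (prodDist q (n / ℓ)) ℓ (e z).1 * prodDist q (n % ℓ) (e z).2 := by
    intro z
    rw [he]
    simp only [prodDist]
    rw [← (blockEquiv n ℓ).prod_comp, Fintype.prod_sum_type, Fintype.prod_prod_type]
  calc _ = ∑ z, prodDist (prodDist q (n / ℓ)) ℓ (e z).1 * prodDist q (n % ℓ) (e z).2 *
        F (e z).1 := by
        refine Finset.sum_congr rfl fun z _ => ?_
        rw [hp z, he]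
    _ = ∑ y, ∑ r, prodDist (prodDist q (n / ℓ)) ℓ y * prodDist q (n % ℓ) r * F y := by
        rw [← Fintype.sum_prod_type']
        exact e.sum_comp fun yr => prodDist (prodDist q (n / ℓ)) ℓ yr.1 *
          prodDist q (n % ℓ) yr.2 * F yr.1
    _ = _ := by
        refine Finset.sum_congr rfl fun y _ => ?_
        rw [← Finset.sum_mul, ← Finset.mul_sum, sum_prodDist hq, mul_one]

/-! ### Moments of a block mean -/

section Moments

variable {Z : Type*} [Fintype Z] {q v : Z → ℝ}

theorem sum_prodDist_sum (hq : ∑ z, q z = 1) (hv : ∑ z, q z * v z = 0) (m : ℕ) :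
    ∑ y, prodDist q m y * ∑ j, v (y j) = 0 := by
  induction m with
  | zero => simp
  | succ m ih =>
    have h : ∀ a, ∑ y : Fin m → Z, prodDist q m y * (v a + ∑ j, v (y j)) = v a := by
      intro a
      simp_rw [mul_add, Finset.sum_add_distrib, ← Finset.sum_mul, ih, sum_prodDist hq]
      ring
    simp_rw [sum_prodDist_succ, Fin.sum_univ_succ, Fin.cons_zero, Fin.cons_succ, h, hv]

theorem sum_prodDist_sum_sq (hq : ∑ z, q z = 1) (hv : ∑ z, q z * v z = 0) (m : ℕ) :
    ∑ y, prodDist q m y * (∑ j, v (y j)) ^ 2 = m * ∑ z, q z * v z ^ 2 := by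
  induction m with
  | zero => simp
  | succ m ih =>
    have h : ∀ a, q a * ∑ y : Fin m → Z, prodDist q m y * (v a + ∑ j, v (y j)) ^ 2 =
        q a * v a ^ 2 + q a * (m * ∑ z, q z * v z ^ 2) := by
      intro a
      have h' : ∀ y : Fin m → Z, prodDist q m y * (v a + ∑ j, v (y j)) ^ 2 =
          v a ^ 2 * prodDist q m y + 2 * v a * (prodDist q m y * ∑ j, v (y j)) +
            prodDist q m y * (∑ j, v (y j)) ^ 2 := fun y => by ring
      simp_rw [h', Finset.sum_add_distrib, ← Finset.mul_sum, ih, sum_prodDist hq,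
        sum_prodDist_sum hq hv]
      ring
    simp_rw [sum_prodDist_succ, Fin.sum_univ_succ, Fin.cons_zero, Fin.cons_succ, h,
      Finset.sum_add_distrib, ← Finset.sum_mul, hq]
    push_cast
    ring

theorem sum_prodDist_sum_cube (hq : ∑ z, q z = 1) (hv : ∑ z, q z * v z = 0) (m : ℕ) :
    ∑ y, prodDist q m y * (∑ j, v (y j)) ^ 3 = m * ∑ z, q z * v z ^ 3 := by
  induction m with
  | zero => simp
  | succ m ih =>
    have h : ∀ a, q a * ∑ y : Fin m → Z, prodDist q m y * (v a + ∑ j, v (y j)) ^ 3 =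
        q a * v a ^ 3 + q a * v a * (3 * (m * ∑ z, q z * v z ^ 2)) +
          q a * (m * ∑ z, q z * v z ^ 3) := by
      intro a
      have h' : ∀ y : Fin m → Z, prodDist q m y * (v a + ∑ j, v (y j)) ^ 3 =
          v a ^ 3 * prodDist q m y + 3 * v a ^ 2 * (prodDist q m y * ∑ j, v (y j)) +
            3 * v a * (prodDist q m y * (∑ j, v (y j)) ^ 2) +
            prodDist q m y * (∑ j, v (y j)) ^ 3 := fun y => by ring
      simp_rw [h', Finset.sum_add_distrib, ← Finset.mul_sum, ih, sum_prodDist hq,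
        sum_prodDist_sum hq hv, sum_prodDist_sum_sq hq hv]
      ring
    simp_rw [sum_prodDist_succ, Fin.sum_univ_succ, Fin.cons_zero, Fin.cons_succ, h,
      Finset.sum_add_distrib, ← Finset.sum_mul, hq, hv]
    push_cast
    ring

theorem sum_prodDist_sum_pow_four (hq : ∑ z, q z = 1) (hv : ∑ z, q z * v z = 0) (m : ℕ) :
    ∑ y, prodDist q m y * (∑ j, v (y j)) ^ 4 =
      m * (∑ z, q z * v z ^ 4) + 3 * m * (m - 1) * (∑ z, q z * v z ^ 2) ^ 2 := by
  induction m with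
  | zero => simp
  | succ m ih =>
    have h : ∀ a, q a * ∑ y : Fin m → Z, prodDist q m y * (v a + ∑ j, v (y j)) ^ 4 =
        q a * v a ^ 4 + q a * v a ^ 2 * (6 * (m * ∑ z, q z * v z ^ 2)) +
          q a * v a * (4 * (m * ∑ z, q z * v z ^ 3)) +
          q a * (m * (∑ z, q z * v z ^ 4) + 3 * m * (m - 1) * (∑ z, q z * v z ^ 2) ^ 2) := by
      intro a
      have h' : ∀ y : Fin m → Z, prodDist q m y * (v a + ∑ j, v (y j)) ^ 4 =
          v a ^ 4 * prodDist q m y + 4 * v a ^ 3 * (prodDist q m y * ∑ j, v (y j)) +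
            6 * v a ^ 2 * (prodDist q m y * (∑ j, v (y j)) ^ 2) +
            4 * v a * (prodDist q m y * (∑ j, v (y j)) ^ 3) +
            prodDist q m y * (∑ j, v (y j)) ^ 4 := fun y => by ring
      simp_rw [h', Finset.sum_add_distrib, ← Finset.mul_sum, ih, sum_prodDist hq,
        sum_prodDist_sum hq hv, sum_prodDist_sum_sq hq hv, sum_prodDist_sum_cube hq hv]
      ring
    simp_rw [sum_prodDist_succ, Fin.sum_univ_succ, Fin.cons_zero, Fin.cons_succ, h,
      Finset.sum_add_distrib, ← Finset.sum_mul, hq, hv]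
    push_cast
    ring

end Moments

/-- Moments of the centred mean `s` of `m` i.i.d. likelihood ratios.  Beyond the exact variance
`χ₂ / m`, the third moment is `O(m⁻²)`, not merely `O(m ^ (-3/2))`. -/
theorem exists_block_moments {Z : Type*} [Fintype Z] {q w : Z → ℝ} (hq0 : ∀ z, 0 ≤ q z)
    (hq : ∑ z, q z = 1) (hw : ∑ z, q z * w z = 1) :
    ∃ C : ℝ, 0 ≤ C ∧ ∀ m : ℕ, 0 < m →
      ∑ y, prodDist q m y * ((∑ j, w (y j)) / (m : ℝ) - 1) = 0 ∧
      ∑ y, prodDist q m y * ((∑ j, w (y j)) / (m : ℝ) - 1) ^ 2 =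
        (∑ z, q z * (w z - 1) ^ 2) / (m : ℝ) ∧
      |∑ y, prodDist q m y * ((∑ j, w (y j)) / (m : ℝ) - 1) ^ 3| ≤ C / (m : ℝ) ^ 2 ∧
      ∑ y, prodDist q m y * ((∑ j, w (y j)) / (m : ℝ) - 1) ^ 4 ≤ C / (m : ℝ) ^ 2 := by
  have hv : ∑ z, q z * (w z - 1) = 0 := by
    simp_rw [mul_sub, Finset.sum_sub_distrib, hw, mul_one, hq, sub_self]
  have hμ4 : 0 ≤ ∑ z, q z * (w z - 1) ^ 4 :=
    Finset.sum_nonneg fun z _ => mul_nonneg (hq0 z) (by positivity)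
  refine ⟨|∑ z, q z * (w z - 1) ^ 3| + ∑ z, q z * (w z - 1) ^ 4 +
    3 * (∑ z, q z * (w z - 1) ^ 2) ^ 2, by positivity, fun m hm => ?_⟩
  have hm1 : (1 : ℝ) ≤ m := by exact_mod_cast hm
  have hm0 : (m : ℝ) ≠ 0 := by positivity
  have hs : ∀ y : Fin m → Z, (∑ j, w (y j)) / m - 1 = (∑ j, (w (y j) - 1)) / m := by
    intro y
    rw [Finset.sum_sub_distrib]
    simp [sub_div, hm0]
  have h1 := sum_prodDist_sum hq hv m
  have h2 := sum_prodDist_sum_sq hq hv m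
  have h3 := sum_prodDist_sum_cube hq hv m
  have h4 := sum_prodDist_sum_pow_four hq hv m
  simp_rw [hs, div_pow, mul_div_assoc', ← Finset.sum_div]
  rw [h1, h2, h3, h4]
  refine ⟨by simp, by field_simp, ?_, ?_⟩
  · rw [abs_div, abs_mul, abs_of_nonneg (by positivity : (0 : ℝ) ≤ m),
      abs_of_nonneg (by positivity : (0 : ℝ) ≤ (m : ℝ) ^ 3)]
    have : (m : ℝ) * |∑ z, q z * (w z - 1) ^ 3| / m ^ 3 = |∑ z, q z * (w z - 1) ^ 3| / m ^ 2 := by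
      field_simp
    rw [this]
    gcongr
    nlinarith [sq_nonneg (∑ z, q z * (w z - 1) ^ 2)]
  · rw [div_le_div_iff₀ (by positivity) (by positivity)]
    have e : ∀ a b c : ℝ, (a + b + 3 * c) * (m : ℝ) ^ 4 -
        (m * b + 3 * m * (m - 1) * c) * m ^ 2 =
        a * m ^ 4 + b * (m ^ 3 * (m - 1)) + 3 * c * m ^ 3 := fun a b c => by ring
    rw [← sub_nonneg, e]
    have : 0 ≤ (m : ℝ) - 1 := by linarith
    positivity

/-! ### Relative entropy -/

theorem nonneg_of_hasDerivAt_nonneg {p p' : ℝ → ℝ} {b : ℝ}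
    (hp : ∀ s ∈ Set.Icc 0 b, HasDerivAt p (p' s) s) (h0 : 0 ≤ p 0)
    (hp' : ∀ s ∈ Set.Icc 0 b, 0 ≤ p' s) : ∀ s ∈ Set.Icc 0 b, 0 ≤ p s := by
  intro s hs
  have hmono : MonotoneOn p (Set.Icc 0 b) := by
    refine monotoneOn_of_hasDerivWithinAt_nonneg (f' := p') (convex_Icc 0 b)
      (fun x hx => (hp x hx).continuousAt.continuousWithinAt) (fun x hx => ?_) (fun x hx => ?_)
    · exact (hp x (interior_subset hx)).hasDerivWithinAt
    · exact hp' x (interior_subset hx)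
  exact h0.trans (hmono ⟨le_rfl, hs.1.trans hs.2⟩ hs hs.1)

theorem log_one_add_le_cubic {s : ℝ} (hs : -1 < s) :
    Real.log (1 + s) ≤ s - s ^ 2 / 2 + s ^ 3 / 3 := by
  have hd : ∀ x : ℝ, -1 < x → HasDerivAt
      (fun x => x - x ^ 2 / 2 + x ^ 3 / 3 - Real.log (1 + x)) (x ^ 3 / (1 + x)) x := by
    intro x hx
    have hx' : 1 + x ≠ 0 := by linarith
    have := ((((hasDerivAt_id x).sub (((hasDerivAt_id x).pow 2).div_const 2)).add
      (((hasDerivAt_id x).pow 3).div_const 3)).sub (((hasDerivAt_id x).const_add 1).log hx'))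
    refine this.congr_deriv ?_
    simp only [id]
    field_simp
    ring
  rcases le_total 0 s with h | h
  · have := nonneg_of_hasDerivAt_nonneg (b := s) (fun x hx => hd x (by linarith [hx.1]))
      (by simp) (fun x hx => div_nonneg (pow_nonneg hx.1 3) (by linarith [hx.1])) s ⟨h, le_rfl⟩
    linarith
  · have hd' : ∀ x ∈ Set.Icc 0 (-s), HasDerivAt
        (fun x => -x - (-x) ^ 2 / 2 + (-x) ^ 3 / 3 - Real.log (1 + -x))
        ((-x) ^ 3 / (1 + -x) * -1) x := by
      intro x hx
      exact (hd (-x) (by linarith [hx.2])).comp x (hasDerivAt_neg x)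
    have := nonneg_of_hasDerivAt_nonneg (b := -s) hd' (by simp) (fun x hx => ?_) (-s)
      ⟨by linarith, le_rfl⟩
    · simp only [neg_neg] at this
      linarith
    · have h1 : 0 < 1 + -x := by linarith [hx.2]
      have h2 : (-x) ^ 3 / (1 + -x) * -1 = x ^ 3 / (1 + -x) := by ring
      rw [h2]
      exact div_nonneg (pow_nonneg hx.1 3) h1.le

theorem mul_log_le_quartic {a : ℝ} (ha : 0 ≤ a) :
    a * Real.log a ≤ (a - 1) + (a - 1) ^ 2 / 2 - (a - 1) ^ 3 / 6 + (a - 1) ^ 4 / 3 := by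
  rcases ha.eq_or_lt with rfl | ha
  · norm_num
  · have h := log_one_add_le_cubic (s := a - 1) (by linarith)
    rw [add_sub_cancel] at h
    refine (mul_le_mul_of_nonneg_left h ha.le).trans (le_of_eq ?_)
    ring

/-- Valid without sign conditions since `Real.log 0 = 0` and `Real.log x = Real.log |x|`. -/
theorem mul_mul_log_mul (x y : ℝ) :
    x * y * Real.log (x * y) = y * (x * Real.log x) + x * (y * Real.log y) := by
  rcases eq_or_ne x 0 with rfl | hx
  · simp
  rcases eq_or_ne y 0 with rfl | hy
  · simp
  rw [Real.log_mul hx hy]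
  ring

/-- The factor `1 *` puts the summand in the form that `sum_prodDist_le_of_step` uses at `x = 1`. -/
theorem relEntropy_ppmOutput_eq {Z : Type*} [Fintype Z] (W : DMC (Fin 2) Z) {w : Z → ℝ}
    (hw : ∀ z, W.prob 1 z = W.prob 0 z * w z) (n ℓ : ℕ) :
    relEntropy (ppmOutput W n ℓ) (prodDist (W.prob 0) n) =
      ∑ y, prodDist (prodDist (W.prob 0) (n / ℓ)) ℓ y *
        ((1 * ∏ i, ((∑ j, w (y i j)) / (n / ℓ : ℕ))) *
          Real.log (1 * ∏ i, ((∑ j, w (y i j)) / (n / ℓ : ℕ)))) := by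
  rw [← sum_prodDist_blocks (W.prob_sum 0) n ℓ fun y =>
    ((1 * ∏ i, ((∑ j, w (y i j)) / (n / ℓ : ℕ))) *
          Real.log (1 * ∏ i, ((∑ j, w (y i j)) / (n / ℓ : ℕ))))]
  refine Finset.sum_congr rfl fun z _ => ?_
  rw [ppmOutput_eq W hw, one_mul]
  rcases eq_or_ne (prodDist (W.prob 0) n z) 0 with h | h
  · simp [h]
  · rw [mul_div_cancel_left₀ _ h, mul_assoc]

theorem relEntropy_ppmOutput_le {Z : Type*} [Fintype Z] (W : DMC (Fin 2) Z) {w : Z → ℝ}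
    (hw : ∀ z, W.prob 1 z = W.prob 0 z * w z) (hw0 : ∀ z, 0 ≤ w z) :
    ∃ C : ℝ, 0 ≤ C ∧ ∀ n ℓ : ℕ, 0 < n / ℓ →
      relEntropy (ppmOutput W n ℓ) (prodDist (W.prob 0) n) ≤
        ℓ * ((∑ z, W.prob 0 z * (w z - 1) ^ 2) / (2 * (n / ℓ : ℕ)) + C / (n / ℓ : ℕ) ^ 2) := by
  have hwsum : ∑ z, W.prob 0 z * w z = 1 := by simp_rw [← hw, W.prob_sum]
  obtain ⟨C, hC, hmom⟩ := exists_block_moments (W.prob_nonneg 0) (W.prob_sum 0) hwsum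
  refine ⟨C, hC, fun n ℓ hm => ?_⟩
  obtain ⟨h1, h2, h3, h4⟩ := hmom _ hm
  rw [relEntropy_ppmOutput_eq W hw]
  have hsum := sum_prodDist (W.prob_sum 0) (n / ℓ)
  have hnn := prodDist_nonneg (W.prob_nonneg 0) (n / ℓ)
  set m := n / ℓ
  set χ := ∑ z, W.prob 0 z * (w z - 1) ^ 2
  set P := prodDist (W.prob 0) m
  set A : (Fin m → Z) → ℝ := fun y => (∑ j, w (y j)) / m with hA
  have hA0 : ∀ y, 0 ≤ A y := fun y =>
    div_nonneg (Finset.sum_nonneg fun j _ => hw0 _) (Nat.cast_nonneg _)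
  have hEA : ∑ y, P y * A y = 1 := by
    have h1' : ∑ y, (P y * A y - P y) = 0 := by simpa [mul_sub] using h1
    rw [Finset.sum_sub_distrib, hsum] at h1'
    linarith
  have hEAlog : ∑ y, P y * (A y * Real.log (A y)) ≤ χ / (2 * m) + C / m ^ 2 := by
    calc ∑ y, P y * (A y * Real.log (A y))
        ≤ ∑ y, (P y * (A y - 1) + P y * (A y - 1) ^ 2 / 2 - P y * (A y - 1) ^ 3 / 6 +
            P y * (A y - 1) ^ 4 / 3) := by
          refine Finset.sum_le_sum fun y _ => ?_
          have := mul_le_mul_of_nonneg_left (mul_log_le_quartic (hA0 y)) (hnn y)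
          refine this.trans (le_of_eq ?_)
          ring
      _ = (χ / m) / 2 - (∑ y, P y * (A y - 1) ^ 3) / 6 + (∑ y, P y * (A y - 1) ^ 4) / 3 := by
          rw [Finset.sum_add_distrib, Finset.sum_sub_distrib, Finset.sum_add_distrib,
            ← Finset.sum_div, ← Finset.sum_div, ← Finset.sum_div, h1, h2, zero_add]
      _ ≤ _ := by
          have h3' := (abs_le.1 h3).1
          have : χ / (2 * m) = χ / m / 2 := by rw [mul_comm, div_div]
          have hCm : 0 ≤ C / (m : ℝ) ^ 2 := by positivity
          rw [this]
          change -(C / (m : ℝ) ^ 2) ≤ ∑ y, P y * (A y - 1) ^ 3 at h3'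
          change ∑ y, P y * (A y - 1) ^ 4 ≤ _ at h4
          linarith
  have := sum_prodDist_le_of_step (q := P) (A := A) hnn (Set.Ici 0)
    (fun x hx y => mul_nonneg hx (hA0 y))
    (fun k x => x * Real.log x + k * x * (χ / (2 * m) + C / m ^ 2)) ℓ
    (fun k _ x hx => ?_) ℓ le_rfl (x := 1) (Set.mem_Ici.2 zero_le_one)
  · simp only [Nat.cast_zero, zero_mul, add_zero, Real.log_one, mul_zero, zero_add,
      mul_one] at this
    exact this
  · have e : ∀ y, P y * (x * A y * Real.log (x * A y) +
        k * (x * A y) * (χ / (2 * m) + C / m ^ 2)) =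
        (P y * A y) * (x * Real.log x + k * x * (χ / (2 * m) + C / m ^ 2)) +
          x * (P y * (A y * Real.log (A y))) := by
      intro y
      rw [mul_mul_log_mul]
      ring
    simp_rw [e]
    rw [Finset.sum_add_distrib, ← Finset.sum_mul, ← Finset.mul_sum, hEA]
    have := mul_le_mul_of_nonneg_left hEAlog (show (0 : ℝ) ≤ x from hx)
    push_cast
    linarith

/-! ### The Gaussian tail function -/

/-- The standard Gaussian density. -/
noncomputable def gaussPhi (t : ℝ) : ℝ := 1 / Real.sqrt (2 * Real.pi) * Real.exp (-t ^ 2 / 2)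

theorem gaussPhi_eq (t : ℝ) :
    gaussPhi t = 1 / Real.sqrt (2 * Real.pi) * Real.exp (-(1 / 2) * t ^ 2) := by
  unfold gaussPhi
  congr 2
  ring

theorem continuous_gaussPhi : Continuous gaussPhi := by
  unfold gaussPhi
  fun_prop

theorem gaussPhi_pos (t : ℝ) : 0 < gaussPhi t := by
  unfold gaussPhi
  positivity

theorem gaussPhi_neg (t : ℝ) : gaussPhi (-t) = gaussPhi t := by
  simp [gaussPhi]

theorem integrable_gaussPhi : Integrable gaussPhi := by
  rw [show gaussPhi = _ from funext gaussPhi_eq]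
  exact (integrable_exp_neg_mul_sq (by norm_num)).const_mul _

theorem integral_gaussPhi : ∫ t, gaussPhi t = 1 := by
  simp_rw [gaussPhi_eq]
  rw [integral_const_mul, integral_gaussian, div_div_eq_mul_div, div_one, mul_comm Real.pi,
    one_div_mul_cancel]
  positivity

theorem gaussQ_eq (x : ℝ) : gaussQ x = ∫ t in Set.Ioi x, gaussPhi t := rfl

theorem gaussQ_eq_sub (x : ℝ) : gaussQ x = gaussQ 0 - ∫ t in (0 : ℝ)..x, gaussPhi t := by
  have := intervalIntegral.integral_Ioi_sub_Ioi' (a := 0) (b := x) (f := gaussPhi)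
    (μ := volume) integrable_gaussPhi.integrableOn integrable_gaussPhi.integrableOn
  rw [← this, gaussQ_eq, gaussQ_eq]
  ring

theorem hasDerivAt_gaussQ (x : ℝ) : HasDerivAt gaussQ (-gaussPhi x) x := by
  rw [show gaussQ = _ from funext gaussQ_eq_sub]
  exact (intervalIntegral.integral_hasDerivAt_right
    (continuous_gaussPhi.intervalIntegrable _ _)
    (continuous_gaussPhi.stronglyMeasurableAtFilter _ _) continuous_gaussPhi.continuousAt).const_sub _

theorem continuous_gaussQ : Continuous gaussQ :=
  continuous_iff_continuousAt.2 fun x => (hasDerivAt_gaussQ x).continuousAt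

theorem gaussQ_neg (x : ℝ) : gaussQ (-x) = 1 - gaussQ x := by
  have h1 := intervalIntegral.integral_Iic_add_Ioi (b := x) (f := gaussPhi) (μ := volume)
    integrable_gaussPhi.integrableOn integrable_gaussPhi.integrableOn
  have h2 := integral_comp_neg_Iic x gaussPhi
  simp_rw [gaussPhi_neg] at h2
  rw [integral_gaussPhi, h2] at h1
  rw [gaussQ_eq, gaussQ_eq]
  linarith

theorem tendsto_gaussQ_atTop : Tendsto gaussQ atTop (𝓝 0) := by
  have h := intervalIntegral_tendsto_integral_Ioi 0
    (integrable_gaussPhi.integrableOn (s := Set.Ioi 0)) tendsto_id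
  have := h.const_sub (gaussQ 0)
  rw [← gaussQ_eq, sub_self] at this
  exact this.congr fun x => (gaussQ_eq_sub x).symm

theorem tendsto_gaussQ_atBot : Tendsto gaussQ atBot (𝓝 1) := by
  have := (tendsto_gaussQ_atTop.comp tendsto_neg_atBot_atTop).const_sub 1
  rw [sub_zero] at this
  refine this.congr fun x => ?_
  simp [gaussQ_neg]

theorem gaussQ_gaussQInv {p : ℝ} (h0 : 0 < p) (h1 : p < 1) : gaussQ (gaussQInv p) = p := by
  refine Function.invFun_eq ?_
  obtain ⟨a, ha⟩ := (tendsto_gaussQ_atTop.eventually_lt_const h0).exists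
  obtain ⟨b, hb⟩ := (tendsto_gaussQ_atBot.eventually_const_lt h1).exists
  exact mem_range_of_exists_le_of_exists_ge continuous_gaussQ ⟨a, ha.le⟩ ⟨b, hb.le⟩

theorem gaussPhi_le_one (t : ℝ) : gaussPhi t ≤ 1 := by
  have h1 : 1 ≤ Real.sqrt (2 * Real.pi) := by
    rw [Real.one_le_sqrt]
    nlinarith [Real.pi_gt_three]
  have h2 : Real.exp (-t ^ 2 / 2) ≤ 1 := Real.exp_le_one_iff.2 (by nlinarith [sq_nonneg t])
  unfold gaussPhi
  exact mul_le_one₀ ((div_le_one (by positivity)).2 h1) (Real.exp_nonneg _) h2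

theorem sq_mul_gaussPhi_le_one (t : ℝ) : t ^ 2 * gaussPhi t ≤ 1 := by
  have h1 : 2 ≤ Real.sqrt (2 * Real.pi) :=
    Real.le_sqrt_of_sq_le (by nlinarith [Real.pi_gt_three])
  have h2 := Real.add_one_le_exp (t ^ 2 / 2)
  have h3 : t ^ 2 * Real.exp (-t ^ 2 / 2) ≤ 2 := by
    rw [neg_div, Real.exp_neg, ← div_eq_mul_inv, div_le_iff₀ (Real.exp_pos _)]
    linarith
  unfold gaussPhi
  calc t ^ 2 * (1 / Real.sqrt (2 * Real.pi) * Real.exp (-t ^ 2 / 2))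
      = (t ^ 2 * Real.exp (-t ^ 2 / 2)) / Real.sqrt (2 * Real.pi) := by ring
    _ ≤ 2 / 2 := by gcongr
    _ = 1 := by norm_num

theorem abs_mul_gaussPhi_le_one (t : ℝ) : |t| * gaussPhi t ≤ 1 := by
  rcases le_total |t| 1 with h | h
  · exact mul_le_one₀ h (gaussPhi_pos t).le (gaussPhi_le_one t)
  · refine le_trans ?_ (sq_mul_gaussPhi_le_one t)
    refine mul_le_mul_of_nonneg_right ?_ (gaussPhi_pos t).le
    rw [← sq_abs]
    nlinarith

theorem hasDerivAt_gaussPhi (t : ℝ) : HasDerivAt gaussPhi (-t * gaussPhi t) t := by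
  have := ((((hasDerivAt_id t).pow 2).neg.div_const 2).exp).const_mul
    (1 / Real.sqrt (2 * Real.pi))
  refine this.congr_deriv ?_
  simp [gaussPhi]
  ring

/-! ### The Black–Scholes put price -/

/-- The Black–Scholes `d₁` with log-strike `k`, variance `t` and spot `x`. -/
noncomputable def bsD1 (k t x : ℝ) : ℝ := (Real.log x - k + t / 2) / Real.sqrt t

/-- The Black–Scholes `d₂ = d₁ - √t`. -/
noncomputable def bsD2 (k t x : ℝ) : ℝ := (Real.log x - k - t / 2) / Real.sqrt t

/-- The Black–Scholes put price: for `x, t > 0`, it is `E (exp k - x * exp N)⁺` where `N` is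
Gaussian with mean `-t / 2` and variance `t`. -/
noncomputable def bsPut (k t x : ℝ) : ℝ :=
  Real.exp k * gaussQ (bsD2 k t x) - x * gaussQ (bsD1 k t x)

theorem bsD1_eq_add (k x : ℝ) {t : ℝ} (ht : 0 < t) : bsD1 k t x = bsD2 k t x + Real.sqrt t := by
  have h : 0 < Real.sqrt t := Real.sqrt_pos.2 ht
  have h2 := Real.sq_sqrt ht.le
  unfold bsD1 bsD2
  field_simp
  rw [h2]
  ring

theorem bsD2_mul_sqrt (k x : ℝ) {t : ℝ} (ht : 0 < t) :
    bsD2 k t x * Real.sqrt t = Real.log x - k - t / 2 :=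
  div_mul_cancel₀ _ (Real.sqrt_pos.2 ht).ne'

theorem mul_gaussPhi_add_sqrt {k t x : ℝ} (ht : 0 < t) (hx : 0 < x) (v : ℝ) :
    x * gaussPhi (v + Real.sqrt t) =
      Real.exp k * gaussPhi v * Real.exp (Real.sqrt t * (bsD2 k t x - v)) := by
  have h := bsD2_mul_sqrt k x ht
  have h2 := Real.sq_sqrt ht.le
  have e : Real.exp (Real.log x) = x := Real.exp_log hx
  unfold gaussPhi
  rw [← e]
  have : Real.log x + -(v + Real.sqrt t) ^ 2 / 2 =
      k + -v ^ 2 / 2 + Real.sqrt t * (bsD2 k t x - v) := by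
    linear_combination -h - h2 / 2
  calc Real.exp (Real.log x) * (1 / Real.sqrt (2 * Real.pi) *
        Real.exp (-(v + Real.sqrt t) ^ 2 / 2))
      = 1 / Real.sqrt (2 * Real.pi) *
        Real.exp (Real.log x + -(v + Real.sqrt t) ^ 2 / 2) := by
        rw [Real.exp_add]; ring
    _ = _ := by
        rw [this, Real.exp_add, Real.exp_add, e]; ring

theorem mul_gaussPhi_bsD1 {k t x : ℝ} (ht : 0 < t) (hx : 0 < x) :
    x * gaussPhi (bsD1 k t x) = Real.exp k * gaussPhi (bsD2 k t x) := by
  rw [bsD1_eq_add k x ht, mul_gaussPhi_add_sqrt (k := k) ht hx]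
  simp

/-- `exp k * gaussQ v - x * gaussQ (v + √t)` decreases to `0` in `v ≥ d₂`, and is the put price at
`v = d₂`. -/
theorem bsPut_nonneg {k t x : ℝ} (ht : 0 < t) (hx : 0 < x) : 0 ≤ bsPut k t x := by
  set h := Real.sqrt t with hh
  have hd : ∀ v, HasDerivAt (fun v => Real.exp k * gaussQ v - x * gaussQ (v + h))
      (Real.exp k * -gaussPhi v - x * -gaussPhi (v + h)) v := fun v =>
    ((hasDerivAt_gaussQ v).const_mul _).sub
      (((hasDerivAt_gaussQ (v + h)).comp_add_const v h).const_mul _)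
  have hanti : AntitoneOn (fun v => Real.exp k * gaussQ v - x * gaussQ (v + h))
      (Set.Ici (bsD2 k t x)) := by
    refine antitoneOn_of_hasDerivWithinAt_nonpos (convex_Ici _)
      (fun v _ => (hd v).continuousAt.continuousWithinAt)
      (fun v _ => (hd v).hasDerivWithinAt) fun v hv => ?_
    have hv' : bsD2 k t x ≤ v := interior_subset hv
    have h1 : Real.exp (h * (bsD2 k t x - v)) ≤ 1 :=
      Real.exp_le_one_iff.2 (mul_nonpos_of_nonneg_of_nonpos (Real.sqrt_nonneg t) (by linarith))
    have h2 := mul_gaussPhi_add_sqrt (k := k) ht hx v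
    have h3 : 0 < Real.exp k * gaussPhi v := mul_pos (Real.exp_pos k) (gaussPhi_pos v)
    rw [← hh] at h2
    nlinarith
  have hlim : Tendsto (fun v => Real.exp k * gaussQ v - x * gaussQ (v + h)) atTop (𝓝 0) := by
    have := (tendsto_gaussQ_atTop.const_mul (Real.exp k)).sub
      ((tendsto_gaussQ_atTop.comp (tendsto_atTop_add_const_right atTop h tendsto_id)).const_mul x)
    simpa using this
  have := le_of_tendsto hlim ((eventually_ge_atTop (bsD2 k t x)).mono fun v hv =>
    hanti (Set.mem_Ici.2 le_rfl) (Set.mem_Ici.2 hv) hv)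
  rwa [bsPut, bsD1_eq_add k x ht]

/-- Put-call symmetry turns nonnegativity of the call into nonnegativity of a put. -/
theorem sub_le_bsPut {k t x : ℝ} (ht : 0 < t) (hx : 0 < x) :
    Real.exp k - x ≤ bsPut k t x := by
  have h := bsPut_nonneg (k := Real.log x) ht (Real.exp_pos k)
  have h1 : bsD1 (Real.log x) t (Real.exp k) = -bsD2 k t x := by
    unfold bsD1 bsD2
    rw [Real.log_exp]
    ring
  have h2 : bsD2 (Real.log x) t (Real.exp k) = -bsD1 k t x := by
    unfold bsD1 bsD2
    rw [Real.log_exp]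
    ring
  rw [bsPut, h1, h2, gaussQ_neg, gaussQ_neg, Real.exp_log hx] at h
  unfold bsPut
  linarith

theorem max_sub_le_bsPut {k t x : ℝ} (ht : 0 < t) (hx : 0 < x) :
    max (Real.exp k - x) 0 ≤ bsPut k t x :=
  max_le (sub_le_bsPut ht hx) (bsPut_nonneg ht hx)

/-- Homogeneity, which reduces every estimate to spot `1`. -/
theorem bsPut_mul (k t : ℝ) {x r : ℝ} (hx : 0 < x) (hr : 0 < r) :
    bsPut k t (x * r) = x * bsPut (k - Real.log x) t r := by
  have h1 : bsD1 k t (x * r) = bsD1 (k - Real.log x) t r := by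
    unfold bsD1
    rw [Real.log_mul hx.ne' hr.ne']
    ring
  have h2 : bsD2 k t (x * r) = bsD2 (k - Real.log x) t r := by
    unfold bsD2
    rw [Real.log_mul hx.ne' hr.ne']
    ring
  unfold bsPut
  rw [h1, h2, Real.exp_sub, Real.exp_log hx]
  field_simp

section Derivatives

variable {k t x : ℝ}

theorem hasDerivAt_bsD1 (hx : 0 < x) :
    HasDerivAt (bsD1 k t) (1 / (x * Real.sqrt t)) x := by
  have := (((Real.hasDerivAt_log hx.ne').sub_const k).add_const (t / 2)).div_const (Real.sqrt t)
  refine this.congr_deriv ?_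
  rw [inv_eq_one_div, div_div]

theorem hasDerivAt_bsD2 (hx : 0 < x) :
    HasDerivAt (bsD2 k t) (1 / (x * Real.sqrt t)) x := by
  have := (((Real.hasDerivAt_log hx.ne').sub_const k).sub_const (t / 2)).div_const (Real.sqrt t)
  refine this.congr_deriv ?_
  rw [inv_eq_one_div, div_div]

theorem hasDerivAt_bsPut (ht : 0 < t) (hx : 0 < x) :
    HasDerivAt (bsPut k t) (-gaussQ (bsD1 k t x)) x := by
  have h1 := ((hasDerivAt_gaussQ (bsD2 k t x)).comp x (hasDerivAt_bsD2 hx)).const_mul (Real.exp k)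
  have h2 := (hasDerivAt_id x).mul ((hasDerivAt_gaussQ (bsD1 k t x)).comp x (hasDerivAt_bsD1 hx))
  refine (h1.sub h2).congr_deriv ?_
  simp only [id, Function.comp]
  linear_combination (1 / (x * Real.sqrt t)) * mul_gaussPhi_bsD1 (k := k) ht hx

theorem hasDerivAt_bsPut_two (hx : 0 < x) :
    HasDerivAt (fun x => -gaussQ (bsD1 k t x)) (gaussPhi (bsD1 k t x) / (x * Real.sqrt t)) x := by
  refine ((hasDerivAt_gaussQ (bsD1 k t x)).comp x (hasDerivAt_bsD1 hx)).neg.congr_deriv ?_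
  ring

theorem hasDerivAt_gaussPhi_bsD1 (hx : 0 < x) :
    HasDerivAt (fun x => gaussPhi (bsD1 k t x))
      (-bsD1 k t x * gaussPhi (bsD1 k t x) * (1 / (x * Real.sqrt t))) x :=
  (hasDerivAt_gaussPhi (bsD1 k t x)).comp x (hasDerivAt_bsD1 hx)

theorem hasDerivAt_bsPut_three (ht : 0 < t) (hx : 0 < x) :
    HasDerivAt (fun x => gaussPhi (bsD1 k t x) / (x * Real.sqrt t))
      (-(gaussPhi (bsD1 k t x) * (bsD1 k t x / t + 1 / Real.sqrt t)) / x ^ 2) x := by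
  have hs : 0 < Real.sqrt t := Real.sqrt_pos.2 ht
  have h2 : t = Real.sqrt t ^ 2 := (Real.sq_sqrt ht.le).symm
  refine ((hasDerivAt_gaussPhi_bsD1 hx).div ((hasDerivAt_id x).mul_const (Real.sqrt t))
    (by simp only [id]; positivity)).congr_deriv ?_
  simp only [id]
  generalize gaussPhi (bsD1 k t x) = φ
  generalize bsD1 k t x = d
  generalize Real.sqrt t = r at *
  subst h2
  field_simp
  ring

theorem hasDerivAt_bsPut_four (ht : 0 < t) (hx : 0 < x) :
    HasDerivAt (fun x => -(gaussPhi (bsD1 k t x) * (bsD1 k t x / t + 1 / Real.sqrt t)) / x ^ 2)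
      (gaussPhi (bsD1 k t x) * (bsD1 k t x ^ 2 / t + 3 * bsD1 k t x / Real.sqrt t + 2 - 1 / t) /
        Real.sqrt t / x ^ 3) x := by
  have hs : 0 < Real.sqrt t := Real.sqrt_pos.2 ht
  have h2 : t = Real.sqrt t ^ 2 := (Real.sq_sqrt ht.le).symm
  refine ((((hasDerivAt_gaussPhi_bsD1 (k := k) (t := t) hx).mul
    (((hasDerivAt_bsD1 hx).div_const t).add_const (1 / Real.sqrt t))).neg).div
    ((hasDerivAt_id x).pow 2) (by simp only [id, Pi.pow_apply]; positivity)).congr_deriv ?_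
  simp only [id, Pi.pow_apply, Pi.mul_apply, Pi.neg_apply]
  generalize gaussPhi (bsD1 k t x) = φ
  generalize bsD1 k t x = d
  generalize Real.sqrt t = r at *
  subst h2
  field_simp
  ring

theorem hasDerivAt_bsD1_time (ht : 0 < t) :
    HasDerivAt (fun t => bsD1 k t x) (-bsD1 k t x / (2 * t) + 1 / (2 * Real.sqrt t)) t := by
  have hs : 0 < Real.sqrt t := Real.sqrt_pos.2 ht
  have h2 : t = Real.sqrt t ^ 2 := (Real.sq_sqrt ht.le).symm
  refine ((((hasDerivAt_id t).div_const 2).const_add (Real.log x - k)).div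
    (Real.hasDerivAt_sqrt ht.ne') hs.ne').congr_deriv ?_
  unfold bsD1
  simp only [id]
  generalize Real.sqrt t = r at *
  subst h2
  field_simp
  ring

theorem hasDerivAt_bsD2_time (ht : 0 < t) :
    HasDerivAt (fun t => bsD2 k t x) (-bsD1 k t x / (2 * t)) t := by
  have hs : 0 < Real.sqrt t := Real.sqrt_pos.2 ht
  have h2 : t = Real.sqrt t ^ 2 := (Real.sq_sqrt ht.le).symm
  refine ((((hasDerivAt_id t).div_const 2).const_sub (Real.log x - k)).div
    (Real.hasDerivAt_sqrt ht.ne') hs.ne').congr_deriv ?_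
  unfold bsD1
  simp only [id]
  generalize Real.sqrt t = r at *
  subst h2
  field_simp
  ring

/-- Together with `hasDerivAt_bsPut_two` this is the Black–Scholes equation
`∂ₜ u = x ^ 2 / 2 * ∂ₓ² u`. -/
theorem hasDerivAt_bsPut_time (ht : 0 < t) (hx : 0 < x) :
    HasDerivAt (fun t => bsPut k t x) (x * gaussPhi (bsD1 k t x) / (2 * Real.sqrt t)) t := by
  have h1 := ((hasDerivAt_gaussQ (bsD2 k t x)).comp t (hasDerivAt_bsD2_time ht)).const_mul
    (Real.exp k)
  have h2 := ((hasDerivAt_gaussQ (bsD1 k t x)).comp t (hasDerivAt_bsD1_time ht)).const_mul x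
  refine (h1.sub h2).congr_deriv ?_
  linear_combination (-bsD1 k t x / (2 * t)) * mul_gaussPhi_bsD1 (k := k) ht hx

theorem hasDerivAt_bsPut_time_two (ht : 0 < t) :
    HasDerivAt (fun t => x * gaussPhi (bsD1 k t x) / (2 * Real.sqrt t))
      (x * (gaussPhi (bsD1 k t x) * (bsD1 k t x ^ 2 / t - bsD1 k t x / Real.sqrt t - 1 / t)) /
        (4 * Real.sqrt t)) t := by
  have hs : 0 < Real.sqrt t := Real.sqrt_pos.2 ht
  have h2 : t = Real.sqrt t ^ 2 := (Real.sq_sqrt ht.le).symm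
  refine ((((hasDerivAt_gaussPhi (bsD1 k t x)).comp t (hasDerivAt_bsD1_time ht)).const_mul x).div
    ((Real.hasDerivAt_sqrt ht.ne').const_mul 2) (by positivity)).congr_deriv ?_
  simp only [Function.comp]
  generalize gaussPhi (bsD1 k t x) = φ
  generalize bsD1 k t x = d
  generalize Real.sqrt t = r at *
  subst h2
  field_simp
  ring

end Derivatives

theorem bsPut_mono_time {k t t' x : ℝ} (ht : 0 < t) (htt : t ≤ t') (hx : 0 < x) :
    bsPut k t x ≤ bsPut k t' x := by
  have hmono : MonotoneOn (fun t => bsPut k t x) (Set.Ici t) := by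
    refine monotoneOn_of_hasDerivWithinAt_nonneg (convex_Ici t)
      (fun s hs => (hasDerivAt_bsPut_time (ht.trans_le hs) hx).continuousAt.continuousWithinAt)
      (fun s hs => (hasDerivAt_bsPut_time (ht.trans_le (interior_subset hs)) hx).hasDerivWithinAt)
      fun s _ => ?_
    have := gaussPhi_pos (bsD1 k s x)
    positivity
  exact hmono (Set.mem_Ici.2 le_rfl) (Set.mem_Ici.2 htt) htt

theorem bsPut_add_time_le {k t s x : ℝ} (ht : 0 < t) (hs : 0 ≤ s) (hx : 0 < x) :
    bsPut k (t + s) x ≤ bsPut k t x + x / (2 * Real.sqrt t) * s := by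
  have hd : ∀ r ∈ Set.Icc 0 s, HasDerivAt
      (fun r => bsPut k t x + x / (2 * Real.sqrt t) * r - bsPut k (t + r) x)
      (x / (2 * Real.sqrt t) * 1 - x * gaussPhi (bsD1 k (t + r) x) / (2 * Real.sqrt (t + r))) r :=
    fun r hr => (((hasDerivAt_id r).const_mul _).const_add _).sub
      ((hasDerivAt_bsPut_time (k := k) (by linarith [hr.1]) hx).comp_const_add t r)
  have := nonneg_of_hasDerivAt_nonneg hd (by simp) (fun r hr => ?_) s ⟨hs, le_rfl⟩
  · linarith
  · rw [mul_one, sub_nonneg]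
    have h1 : Real.sqrt t ≤ Real.sqrt (t + r) := Real.sqrt_le_sqrt (by linarith [hr.1])
    have h2 := Real.sqrt_pos.2 ht
    have h3 := gaussPhi_le_one (bsD1 k (t + r) x)
    gcongr
    nlinarith

section Bounds

variable {k t x T : ℝ}

theorem abs_bsPut_three_le (ht : 0 < t) (htT : t ≤ T) (hx : 0 < x) :
    |-(gaussPhi (bsD1 k t x) * (bsD1 k t x / t + 1 / Real.sqrt t)) / x ^ 2| ≤
      (4 + 4 * T) / (t * Real.sqrt t) / x ^ 2 := by
  have hs : 0 < Real.sqrt t := Real.sqrt_pos.2 ht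
  have h2 : t = Real.sqrt t ^ 2 := (Real.sq_sqrt ht.le).symm
  have a1 := gaussPhi_le_one (bsD1 k t x)
  have a2 := abs_mul_gaussPhi_le_one (bsD1 k t x)
  have a0 := gaussPhi_pos (bsD1 k t x)
  rw [abs_div, abs_neg, abs_of_pos (by positivity : 0 < x ^ 2)]
  gcongr
  generalize gaussPhi (bsD1 k t x) = φ at *
  generalize bsD1 k t x = d at *
  generalize Real.sqrt t = r at *
  subst h2
  have b : |φ * (d / r ^ 2 + 1 / r)| ≤ 1 / r ^ 2 + 1 / r := by
    calc |φ * (d / r ^ 2 + 1 / r)| = |d * φ / r ^ 2 + φ / r| := by congr 1; ring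
      _ ≤ |d * φ / r ^ 2| + |φ / r| := abs_add_le _ _
      _ = |d| * φ / r ^ 2 + φ / r := by
        rw [abs_div, abs_div, abs_mul, abs_of_pos a0, abs_of_pos hs,
          abs_of_pos (by positivity : 0 < r ^ 2)]
      _ ≤ _ := by gcongr
  refine b.trans ?_
  rw [show 1 / r ^ 2 + 1 / r = (r + r ^ 2) / (r ^ 2 * r) by field_simp]
  refine div_le_div_of_nonneg_right ?_ (by positivity)
  nlinarith [sq_nonneg (r - 1)]

theorem abs_bsPut_four_le (ht : 0 < t) (htT : t ≤ T) (hx : 0 < x) :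
    |gaussPhi (bsD1 k t x) * (bsD1 k t x ^ 2 / t + 3 * bsD1 k t x / Real.sqrt t + 2 - 1 / t) /
        Real.sqrt t / x ^ 3| ≤ (4 + 4 * T) / (t * Real.sqrt t) / x ^ 3 := by
  have hs : 0 < Real.sqrt t := Real.sqrt_pos.2 ht
  have h2 : t = Real.sqrt t ^ 2 := (Real.sq_sqrt ht.le).symm
  have a1 := gaussPhi_le_one (bsD1 k t x)
  have a2 := abs_mul_gaussPhi_le_one (bsD1 k t x)
  have a3 := sq_mul_gaussPhi_le_one (bsD1 k t x)
  have a0 := gaussPhi_pos (bsD1 k t x)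
  rw [abs_div, abs_of_pos (by positivity : 0 < x ^ 3)]
  gcongr
  generalize gaussPhi (bsD1 k t x) = φ at *
  generalize bsD1 k t x = d at *
  generalize Real.sqrt t = r at *
  subst h2
  have a4 : |d * φ| ≤ 1 := by rwa [abs_mul, abs_of_pos a0]
  have a4' := abs_le.1 a4
  have a5 : 0 ≤ d ^ 2 * φ := by positivity
  rw [show φ * (d ^ 2 / r ^ 2 + 3 * d / r + 2 - 1 / r ^ 2) / r =
    (d ^ 2 * φ + 3 * r * (d * φ) + 2 * r ^ 2 * φ - φ) / (r ^ 2 * r) by field_simp,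
    abs_div, abs_of_pos (by positivity : 0 < r ^ 2 * r)]
  gcongr
  rw [abs_le]
  constructor <;> nlinarith [sq_nonneg (r - 1), mul_le_mul_of_nonneg_left a1 (sq_nonneg r),
    mul_le_mul_of_nonneg_left a4'.1 hs.le, mul_le_mul_of_nonneg_left a4'.2 hs.le,
    mul_nonneg (sq_nonneg r) a0.le]

theorem neg_le_bsPut_time_two (ht : 0 < t) (htT : t ≤ T) (hx : 0 < x) :
    -(x * ((4 + 4 * T) / (t * Real.sqrt t))) ≤
      x * (gaussPhi (bsD1 k t x) * (bsD1 k t x ^ 2 / t - bsD1 k t x / Real.sqrt t - 1 / t)) /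
        (4 * Real.sqrt t) := by
  have hs : 0 < Real.sqrt t := Real.sqrt_pos.2 ht
  have h2 : t = Real.sqrt t ^ 2 := (Real.sq_sqrt ht.le).symm
  have a1 := gaussPhi_le_one (bsD1 k t x)
  have a2 := abs_mul_gaussPhi_le_one (bsD1 k t x)
  have a0 := gaussPhi_pos (bsD1 k t x)
  generalize gaussPhi (bsD1 k t x) = φ at *
  generalize bsD1 k t x = d at *
  generalize Real.sqrt t = r at *
  subst h2
  have a4 : |d * φ| ≤ 1 := by rwa [abs_mul, abs_of_pos a0]
  have a4' := abs_le.1 a4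
  have a5 : 0 ≤ d ^ 2 * φ := by positivity
  rw [show x * (φ * (d ^ 2 / r ^ 2 - d / r - 1 / r ^ 2)) / (4 * r) =
    x * ((d ^ 2 * φ - r * (d * φ) - φ) / 4 / (r ^ 2 * r)) by field_simp, ← mul_neg, ← neg_div]
  gcongr
  nlinarith [sq_nonneg (r - 1), mul_le_mul_of_nonneg_left a4'.2 hs.le]

end Bounds

/-- Fourth-order Taylor upper bound to the right of `0`. -/
theorem taylor_four_le_right {f f1 f2 f3 f4 : ℝ → ℝ} {M b : ℝ} (hb : 0 ≤ b)
    (h0 : ∀ s ∈ Set.Icc 0 b, HasDerivAt f (f1 s) s)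
    (h1 : ∀ s ∈ Set.Icc 0 b, HasDerivAt f1 (f2 s) s)
    (h2 : ∀ s ∈ Set.Icc 0 b, HasDerivAt f2 (f3 s) s)
    (h3 : ∀ s ∈ Set.Icc 0 b, HasDerivAt f3 (f4 s) s)
    (h4 : ∀ s ∈ Set.Icc 0 b, f4 s ≤ M) :
    f b ≤ f 0 + f1 0 * b + f2 0 * b ^ 2 / 2 + f3 0 * b ^ 3 / 6 + M * b ^ 4 / 24 := by
  have p3 := nonneg_of_hasDerivAt_nonneg (p := fun s => f3 0 + M * s - f3 s) (b := b)
    (fun s hs => (((hasDerivAt_id s).const_mul M).const_add _).sub (h3 s hs)) (by simp)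
    (fun s hs => by simpa using h4 s hs)
  have p2 := nonneg_of_hasDerivAt_nonneg (p := fun s => f2 0 + f3 0 * s + M * s ^ 2 / 2 - f2 s)
    (p' := fun s => f3 0 + M * s - f3 s) (b := b)
    (fun s hs => ((((((hasDerivAt_id s).const_mul (f3 0)).const_add (f2 0)).add
      ((((hasDerivAt_id s).pow 2).const_mul M).div_const 2)).sub (h2 s hs)).congr_deriv
        (by simp only [id]; ring))) (by simp) p3
  have p1 := nonneg_of_hasDerivAt_nonneg
    (p := fun s => f1 0 + f2 0 * s + f3 0 * s ^ 2 / 2 + M * s ^ 3 / 6 - f1 s)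
    (p' := fun s => f2 0 + f3 0 * s + M * s ^ 2 / 2 - f2 s) (b := b)
    (fun s hs => (((((((hasDerivAt_id s).const_mul (f2 0)).const_add (f1 0)).add
      ((((hasDerivAt_id s).pow 2).const_mul (f3 0)).div_const 2)).add
      ((((hasDerivAt_id s).pow 3).const_mul M).div_const 6)).sub (h1 s hs)).congr_deriv
        (by simp only [id]; ring))) (by simp) p2
  have p0 := nonneg_of_hasDerivAt_nonneg
    (p := fun s => f 0 + f1 0 * s + f2 0 * s ^ 2 / 2 + f3 0 * s ^ 3 / 6 + M * s ^ 4 / 24 - f s)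
    (p' := fun s => f1 0 + f2 0 * s + f3 0 * s ^ 2 / 2 + M * s ^ 3 / 6 - f1 s) (b := b)
    (fun s hs => ((((((((hasDerivAt_id s).const_mul (f1 0)).const_add (f 0)).add
      ((((hasDerivAt_id s).pow 2).const_mul (f2 0)).div_const 2)).add
      ((((hasDerivAt_id s).pow 3).const_mul (f3 0)).div_const 6)).add
      ((((hasDerivAt_id s).pow 4).const_mul M).div_const 24)).sub (h0 s hs)).congr_deriv
        (by simp only [id]; ring))) (by simp) p1
  have := p0 b ⟨hb, le_rfl⟩
  linarith

theorem taylor_four_le {f f1 f2 f3 f4 : ℝ → ℝ} {M b : ℝ}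
    (h0 : ∀ s ∈ Set.uIcc 0 b, HasDerivAt f (f1 s) s)
    (h1 : ∀ s ∈ Set.uIcc 0 b, HasDerivAt f1 (f2 s) s)
    (h2 : ∀ s ∈ Set.uIcc 0 b, HasDerivAt f2 (f3 s) s)
    (h3 : ∀ s ∈ Set.uIcc 0 b, HasDerivAt f3 (f4 s) s)
    (h4 : ∀ s ∈ Set.uIcc 0 b, f4 s ≤ M) :
    f b ≤ f 0 + f1 0 * b + f2 0 * b ^ 2 / 2 + f3 0 * b ^ 3 / 6 + M * b ^ 4 / 24 := by
  rcases le_total 0 b with hb | hb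
  · rw [Set.uIcc_of_le hb] at *
    exact taylor_four_le_right hb h0 h1 h2 h3 h4
  · rw [Set.uIcc_of_ge hb] at *
    have hm : ∀ s ∈ Set.Icc 0 (-b), -s ∈ Set.Icc b 0 := fun s hs =>
      ⟨by linarith [hs.2], by linarith [hs.1]⟩
    have := taylor_four_le_right (f := fun s => f (-s)) (f1 := fun s => -f1 (-s))
      (f2 := fun s => f2 (-s)) (f3 := fun s => -f3 (-s)) (f4 := fun s => f4 (-s))
      (b := -b) (M := M) (by linarith)
      (fun s hs => ((h0 _ (hm s hs)).comp s (hasDerivAt_neg s)).congr_deriv (by ring))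
      (fun s hs => ((h1 _ (hm s hs)).comp s (hasDerivAt_neg s)).neg.congr_deriv (by ring))
      (fun s hs => ((h2 _ (hm s hs)).comp s (hasDerivAt_neg s)).congr_deriv (by ring))
      (fun s hs => ((h3 _ (hm s hs)).comp s (hasDerivAt_neg s)).neg.congr_deriv (by ring))
      (fun s hs => h4 _ (hm s hs))
    simp only [neg_neg, neg_zero] at this
    refine this.trans (le_of_eq ?_)
    ring

/-- Second-order lower bound for the put price in the time variable. -/
theorem bsPut_add_time_ge {k t τ T : ℝ} (ht : 0 < t) (hτ : 0 ≤ τ) (htT : t + τ ≤ T) :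
    bsPut k t 1 + gaussPhi (bsD1 k t 1) / Real.sqrt t * τ / 2 -
      (4 + 4 * T) / (t * Real.sqrt t) * τ ^ 2 / 2 ≤ bsPut k (t + τ) 1 := by
  set N := (4 + 4 * T) / (t * Real.sqrt t) with hN
  have hs := Real.sqrt_pos.2 ht
  set g : ℝ → ℝ := fun t => 1 * gaussPhi (bsD1 k t 1) / (2 * Real.sqrt t) with hg
  have p1 := nonneg_of_hasDerivAt_nonneg (p := fun s => g (t + s) + N * s - g t) (b := τ)
    (fun s hs => (((hasDerivAt_bsPut_time_two (k := k) (x := 1)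
      (show 0 < t + s by linarith [hs.1])).comp_const_add t s).add
        ((hasDerivAt_id s).const_mul N)).sub_const (g t)) (by simp) (fun s hs' => by
      have h1 : 0 < t + s := by linarith [hs'.1]
      have := neg_le_bsPut_time_two (k := k) h1 (by linarith [hs'.2]) one_pos (T := T)
      have h2 : (4 + 4 * T) / ((t + s) * Real.sqrt (t + s)) ≤ N := by
        rw [hN]
        have : 0 ≤ 4 + 4 * T := by linarith
        have h3 : Real.sqrt t ≤ Real.sqrt (t + s) := Real.sqrt_le_sqrt (by linarith [hs'.1])
        have h4 : t ≤ t + s := by linarith [hs'.1]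
        gcongr
      rw [one_mul] at this
      linarith)
  have p0 := nonneg_of_hasDerivAt_nonneg
    (p := fun s => bsPut k (t + s) 1 + N * s ^ 2 / 2 - g t * s - bsPut k t 1)
    (p' := fun s => g (t + s) + N * s - g t) (b := τ)
    (fun s hs => (((((hasDerivAt_bsPut_time (k := k) (x := 1)
      (show 0 < t + s by linarith [hs.1]) one_pos).comp_const_add t s).add
        ((((hasDerivAt_id s).pow 2).const_mul N).div_const 2)).sub
        ((hasDerivAt_id s).const_mul (g t))).sub_const (bsPut k t 1)).congr_deriv
        (by simp only [id, hg]; ring)) (by simp) p1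
  have := p0 τ ⟨hτ, le_rfl⟩
  have e : g t * τ = gaussPhi (bsD1 k t 1) / Real.sqrt t * τ / 2 := by
    simp only [hg]
    field_simp
  simp only [e] at this
  linarith

/-- Taylor expansion of the put price in the spot around `1`. The lower bound `a` on `1 + s` controls
the fourth derivative. -/
theorem bsPut_taylor_le {k t a s T : ℝ} (ht : 0 < t) (htT : t ≤ T) (ha : 0 < a) (ha1 : a ≤ 1)
    (has : a ≤ 1 + s) :
    bsPut k t (1 + s) ≤ bsPut k t 1 + -gaussQ (bsD1 k t 1) * s +
      gaussPhi (bsD1 k t 1) / Real.sqrt t * s ^ 2 / 2 +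
      -(gaussPhi (bsD1 k t 1) * (bsD1 k t 1 / t + 1 / Real.sqrt t)) * s ^ 3 / 6 +
      (4 + 4 * T) / (t * Real.sqrt t) / a ^ 3 * s ^ 4 / 24 := by
  have hs := Real.sqrt_pos.2 ht
  have hpos : ∀ r ∈ Set.uIcc 0 s, a ≤ 1 + r := by
    intro r hr
    rcases Set.mem_uIcc.1 hr with h | h <;> linarith [h.1]
  have := taylor_four_le (f := fun r => bsPut k t (1 + r)) (b := s)
    (M := (4 + 4 * T) / (t * Real.sqrt t) / a ^ 3)
    (fun r hr => (hasDerivAt_bsPut (k := k) ht (ha.trans_le (hpos r hr))).comp_const_add 1 r)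
    (fun r hr => (hasDerivAt_bsPut_two (k := k) (t := t)
      (ha.trans_le (hpos r hr))).comp_const_add 1 r)
    (fun r hr => (hasDerivAt_bsPut_three (k := k) ht (ha.trans_le (hpos r hr))).comp_const_add 1 r)
    (fun r hr => (hasDerivAt_bsPut_four (k := k) ht (ha.trans_le (hpos r hr))).comp_const_add 1 r)
    (fun r hr => by
      have h1 := hpos r hr
      refine (le_abs_self _).trans ((abs_bsPut_four_le ht htT (ha.trans_le h1)).trans ?_)
      have : 0 ≤ 4 + 4 * T := by linarith
      gcongr)
  simpa using this

/-! ### Comparison with the Black–Scholes flow -/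

/-- Bounds the one-step error `τ * t ^ (-3/2)` by an increment of `-4 * t ^ (-1/2)`, so that the
errors telescope. -/
theorem div_le_inv_sqrt_sub_inv_sqrt {t τ : ℝ} (hτ : 0 < τ) (hτt : τ ≤ t) :
    τ / (t * Real.sqrt t) ≤ 4 * (1 / Real.sqrt t - 1 / Real.sqrt (t + τ)) := by
  have ht : 0 < t := hτ.trans_le hτt
  have h1 := Real.sq_sqrt ht.le
  have h2 := Real.sq_sqrt (show 0 ≤ t + τ by linarith)
  have p1 := Real.sqrt_pos.2 ht
  have p2 := Real.sqrt_pos.2 (show 0 < t + τ by linarith)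
  have h3 : Real.sqrt (t + τ) ≤ 3 / 2 * Real.sqrt t := by
    rw [Real.sqrt_le_iff]
    refine ⟨by positivity, ?_⟩
    rw [mul_pow, h1]
    linarith
  generalize Real.sqrt t = r at *
  generalize Real.sqrt (t + τ) = r' at *
  have hτ' : τ = r' ^ 2 - r ^ 2 := by linarith
  have hle : r ≤ r' := by nlinarith
  rw [← h1, hτ', div_sub_div _ _ p1.ne' p2.ne', mul_div_assoc', div_le_div_iff₀ (by positivity)
    (by positivity)]
  have e : 4 * (1 * r' - r * 1) * (r ^ 2 * r) - (r' ^ 2 - r ^ 2) * (r * r') =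
      r * (r' - r) * (4 * r ^ 2 - r' * (r' + r)) := by ring
  rw [← sub_nonneg, e]
  have : 0 ≤ 4 * r ^ 2 - r' * (r' + r) := by nlinarith
  have : 0 ≤ r' - r := by linarith
  positivity

/-- One step of the comparison with the Black–Scholes flow: multiplying the spot by a nearly
Gaussian factor `A` of mean one and variance `τ` advances time by `τ`, up to an error which
telescopes along the flow. -/
theorem sum_bsPut_mul_le {Y : Type*} [Fintype Y] {q A : Y → ℝ} (hq0 : ∀ y, 0 ≤ q y)
    (hq : ∑ y, q y = 1) {a : ℝ} (ha : 0 < a) (ha1 : a ≤ 1) (hA : ∀ y, a ≤ A y) {τ η : ℝ}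
    (hτ : 0 < τ) (hη : 0 ≤ η) (m1 : ∑ y, q y * (A y - 1) = 0) (m2 : ∑ y, q y * (A y - 1) ^ 2 = τ)
    (m3 : |∑ y, q y * (A y - 1) ^ 3| ≤ η) (m4 : ∑ y, q y * (A y - 1) ^ 4 ≤ η)
    {t T : ℝ} (hτt : τ ≤ t) (htT : t + τ ≤ T) (k : ℝ) {x : ℝ} (hx : 0 < x) :
    ∑ y, q y * bsPut k t (x * A y) ≤ bsPut k (t + τ) x +
      4 * (4 + 4 * T) * (η / 6 + η / (24 * a ^ 3) + τ ^ 2 / 2) / τ * x *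
        (1 / Real.sqrt t - 1 / Real.sqrt (t + τ)) := by
  have ht : 0 < t := hτ.trans_le hτt
  have hs := Real.sqrt_pos.2 ht
  set κ := k - Real.log x with hκ
  set M := (4 + 4 * T) / (t * Real.sqrt t) with hM
  have hM0 : 0 ≤ M := by
    have : 0 ≤ 4 + 4 * T := by linarith
    positivity
  set E := η / 6 + η / (24 * a ^ 3) + τ ^ 2 / 2 with hE
  have hE0 : 0 ≤ E := by positivity
  have key : ∑ y, q y * bsPut κ t (A y) ≤ bsPut κ (t + τ) 1 + M * E := by
    set c1 := -gaussQ (bsD1 κ t 1)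
    set c2 := gaussPhi (bsD1 κ t 1) / Real.sqrt t with hc2
    set c3 := -(gaussPhi (bsD1 κ t 1) * (bsD1 κ t 1 / t + 1 / Real.sqrt t)) with hc3
    have hc3' : |c3| ≤ M := by
      have := abs_bsPut_three_le (k := κ) ht (by linarith : t ≤ T) one_pos
      rwa [one_pow, div_one, div_one] at this
    calc ∑ y, q y * bsPut κ t (A y)
        ≤ ∑ y, (q y * bsPut κ t 1 + c1 * (q y * (A y - 1)) + c2 / 2 * (q y * (A y - 1) ^ 2) +
            c3 / 6 * (q y * (A y - 1) ^ 3) + M / a ^ 3 / 24 * (q y * (A y - 1) ^ 4)) := by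
          refine Finset.sum_le_sum fun y _ => ?_
          have := bsPut_taylor_le (k := κ) (s := A y - 1) ht (by linarith : t ≤ T) ha ha1
            (by linarith [hA y])
          rw [add_sub_cancel] at this
          refine (mul_le_mul_of_nonneg_left this (hq0 y)).trans (le_of_eq ?_)
          ring
      _ = bsPut κ t 1 + c2 / 2 * τ + c3 / 6 * (∑ y, q y * (A y - 1) ^ 3) +
            M / a ^ 3 / 24 * ∑ y, q y * (A y - 1) ^ 4 := by
          simp_rw [Finset.sum_add_distrib, ← Finset.mul_sum, ← Finset.sum_mul, m1, m2, hq]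
          ring
      _ ≤ bsPut κ t 1 + c2 / 2 * τ + M / 6 * η + M / a ^ 3 / 24 * η := by
          have h3 : c3 * (∑ y, q y * (A y - 1) ^ 3) ≤ M * η := by
            refine (le_abs_self _).trans ?_
            rw [abs_mul]
            gcongr
          have h4 : M / a ^ 3 / 24 * ∑ y, q y * (A y - 1) ^ 4 ≤ M / a ^ 3 / 24 * η := by gcongr
          linarith
      _ ≤ _ := by
          have := bsPut_add_time_ge (k := κ) ht hτ.le htT
          have e : M * E = M / 6 * η + M / a ^ 3 / 24 * η + M * τ ^ 2 / 2 := by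
            rw [hE]
            field_simp
          rw [e]
          linarith
  have hx' : bsPut k (t + τ) x = x * bsPut κ (t + τ) 1 := by
    have := bsPut_mul k (t + τ) hx one_pos
    rwa [mul_one] at this
  have hsum : ∑ y, q y * bsPut k t (x * A y) = x * ∑ y, q y * bsPut κ t (A y) := by
    rw [Finset.mul_sum]
    refine Finset.sum_congr rfl fun y _ => ?_
    rw [bsPut_mul k t hx (ha.trans_le (hA y))]
    ring
  rw [hsum, hx']
  have htel := div_le_inv_sqrt_sub_inv_sqrt hτ hτt
  have hME : M * E ≤ 4 * (4 + 4 * T) * E / τ * (1 / Real.sqrt t - 1 / Real.sqrt (t + τ)) := by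
    have h0 : 0 ≤ (4 + 4 * T) * E / τ := by
      have : 0 ≤ 4 + 4 * T := by linarith
      positivity
    calc M * E = (4 + 4 * T) * E / τ * (τ / (t * Real.sqrt t)) := by
          rw [hM]
          field_simp
      _ ≤ (4 + 4 * T) * E / τ * (4 * (1 / Real.sqrt t - 1 / Real.sqrt (t + τ))) := by gcongr
      _ = _ := by ring
  calc x * ∑ y, q y * bsPut κ t (A y) ≤ x * (bsPut κ (t + τ) 1 + 4 * (4 + 4 * T) * E / τ *
        (1 / Real.sqrt t - 1 / Real.sqrt (t + τ))) := by
        gcongr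
        linarith
    _ = _ := by ring

/-- Comparison of the product of `ℓ` independent copies of `A`, started from variance `ε`, with the
Black–Scholes flow. -/
theorem sum_prodDist_max_le {Y : Type*} [Fintype Y] {q A : Y → ℝ} (hq0 : ∀ y, 0 ≤ q y)
    (hq : ∑ y, q y = 1) {a : ℝ} (ha : 0 < a) (ha1 : a ≤ 1) (hA : ∀ y, a ≤ A y) {τ η : ℝ}
    (hτ : 0 < τ) (hη : 0 ≤ η) (m1 : ∑ y, q y * (A y - 1) = 0) (m2 : ∑ y, q y * (A y - 1) ^ 2 = τ)
    (m3 : |∑ y, q y * (A y - 1) ^ 3| ≤ η) (m4 : ∑ y, q y * (A y - 1) ^ 4 ≤ η)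
    (ℓ : ℕ) {ε T : ℝ} (hτε : τ ≤ ε) (hT : ε + ℓ * τ ≤ T) (k : ℝ) :
    ∑ y, prodDist q ℓ y * max (Real.exp k - ∏ i, A (y i)) 0 ≤ bsPut k (ε + ℓ * τ) 1 +
      4 * (4 + 4 * T) * (η / 6 + η / (24 * a ^ 3) + τ ^ 2 / 2) / τ * (1 / Real.sqrt ε) := by
  set B := 4 * (4 + 4 * T) * (η / 6 + η / (24 * a ^ 3) + τ ^ 2 / 2) / τ with hB
  have hε : 0 < ε := hτ.trans_le hτε
  have hT0 : 0 ≤ 4 + 4 * T := by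
    have : 0 ≤ (ℓ : ℝ) * τ := by positivity
    linarith
  have hB0 : 0 ≤ B := by positivity
  have hEA : ∑ y, q y * A y = 1 := by
    simp_rw [mul_sub, mul_one, Finset.sum_sub_distrib, hq] at m1
    linarith
  have := sum_prodDist_le_of_step (q := q) (A := A) hq0 (Set.Ioi 0)
    (fun x hx y => mul_pos hx (ha.trans_le (hA y)))
    (fun j x => bsPut k (ε + j * τ) x - B * x * (1 / Real.sqrt (ε + j * τ))) ℓ
    (fun j hj x hx => ?_) ℓ le_rfl (x := 1) (Set.mem_Ioi.2 one_pos)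
  · have hsum : ∑ y : Fin ℓ → Y, prodDist q ℓ y * ∏ i, A (y i) = 1 := by
      have : ∀ y : Fin ℓ → Y, prodDist q ℓ y * ∏ i, A (y i) =
          prodDist (fun b => q b * A b) ℓ y := fun y => by
        rw [prodDist, prodDist, Finset.prod_mul_distrib]
      simp_rw [this]
      exact sum_prodDist hEA ℓ
    have hle : ∑ y, prodDist q ℓ y * max (Real.exp k - ∏ i, A (y i)) 0 ≤
        ∑ y, prodDist q ℓ y * bsPut k ε (∏ i, A (y i)) :=
      Finset.sum_le_sum fun y _ => mul_le_mul_of_nonneg_left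
        (max_sub_le_bsPut hε (Finset.prod_pos fun i _ => ha.trans_le (hA _)))
        (prodDist_nonneg hq0 ℓ y)
    simp only [Nat.cast_zero, zero_mul, add_zero, one_mul, mul_one] at this
    have e : ∀ y : Fin ℓ → Y, prodDist q ℓ y * (bsPut k ε (∏ i, A (y i)) -
        B * (∏ i, A (y i)) * (1 / Real.sqrt ε)) = prodDist q ℓ y * bsPut k ε (∏ i, A (y i)) -
        B * (1 / Real.sqrt ε) * (prodDist q ℓ y * ∏ i, A (y i)) := fun y => by ring
    simp_rw [e] at this
    rw [Finset.sum_sub_distrib, ← Finset.mul_sum, hsum, mul_one] at this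
    have h0 : 0 ≤ B * (1 / Real.sqrt (ε + ℓ * τ)) := by positivity
    linarith
  · have hjT : ε + j * τ + τ ≤ T := by
      have : ((j + 1 : ℕ) : ℝ) ≤ ℓ := by exact_mod_cast hj
      push_cast at this
      nlinarith
    have hjε : τ ≤ ε + j * τ := by
      have : 0 ≤ (j : ℝ) * τ := by positivity
      linarith
    have h := sum_bsPut_mul_le hq0 hq ha ha1 hA hτ hη m1 m2 m3 m4 hjε hjT k hx
    have e : ∀ y, q y * (bsPut k (ε + j * τ) (x * A y) -
        B * (x * A y) * (1 / Real.sqrt (ε + j * τ))) = q y * bsPut k (ε + j * τ) (x * A y) -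
        q y * A y * (B * x * (1 / Real.sqrt (ε + j * τ))) := fun y => by ring
    simp_rw [e]
    rw [Finset.sum_sub_distrib, ← Finset.sum_mul, hEA]
    push_cast
    rw [show ε + (j + 1 : ℝ) * τ = ε + j * τ + τ by ring]
    linarith

/-! ### The single-letter likelihood ratio -/

/-- A likelihood ratio `w = dQ₁ / dQ₀`, set to `1` outside the support of `Q₀` so that mutual
absolute continuity bounds it away from `0` everywhere. -/
theorem exists_likelihoodRatio {Z : Type*} [Fintype Z] (W : DMC (Fin 2) Z)
    (hac : AbsCont (W.prob 1) (W.prob 0)) :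
    ∃ w : Z → ℝ, (∀ z, W.prob 1 z = W.prob 0 z * w z) ∧ (∀ z, 0 ≤ w z) ∧
      (∀ z, W.prob 0 z = 0 → w z = 1) ∧
      (AbsCont (W.prob 0) (W.prob 1) → ∃ a, 0 < a ∧ a ≤ 1 ∧ ∀ z, a ≤ w z) := by
  classical
  refine ⟨fun z => if W.prob 0 z = 0 then 1 else W.prob 1 z / W.prob 0 z, fun z => ?_, fun z => ?_,
    fun z hz => if_pos hz, fun hac' => ?_⟩
  · dsimp only
    split_ifs with h
    · rw [hac z h, h, zero_mul]
    · rw [mul_div_cancel₀ _ h]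
  · dsimp only
    split_ifs
    · exact zero_le_one
    · exact div_nonneg (W.prob_nonneg 1 z) (W.prob_nonneg 0 z)
  · set w : Z → ℝ := fun z => if W.prob 0 z = 0 then 1 else W.prob 1 z / W.prob 0 z with hw
    have hpos : ∀ z, 0 < w z := by
      intro z
      simp only [hw]
      split_ifs with h
      · exact zero_lt_one
      · have h1 : W.prob 1 z ≠ 0 := fun h1 => h (hac' z h1)
        exact div_pos ((W.prob_nonneg 1 z).lt_of_ne' h1) ((W.prob_nonneg 0 z).lt_of_ne' h)
    cases isEmpty_or_nonempty Z with
    | inl _ => exact ⟨1, one_pos, le_rfl, fun z => isEmptyElim z⟩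
    | inr _ =>
      obtain ⟨z₀, hz₀⟩ := Finite.exists_min w
      exact ⟨min 1 (w z₀), lt_min one_pos (hpos z₀), min_le_left _ _,
        fun z => (min_le_right _ _).trans (hz₀ z)⟩

theorem chiSq_eq {Z : Type*} [Fintype Z] {P Q w : Z → ℝ} (hw : ∀ z, P z = Q z * w z) :
    chiSq P Q = ∑ z, Q z * (w z - 1) ^ 2 := by
  refine Finset.sum_congr rfl fun z _ => ?_
  rw [hw]
  rcases eq_or_ne (Q z) 0 with h | h
  · simp [h]
  · field_simp

/-! ### Relations between the length and the number of blocks -/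

section Arithmetic

variable {n ℓ : ℕ} {c₁ c₂ χ : ℝ}

theorem mul_chi_div_le (hm : 0 < n / ℓ) (hℓ : 0 < ℓ) (hc : (ℓ : ℝ) ≤ c₂ * ((n / ℓ : ℕ) : ℝ))
    (hχ : 0 ≤ χ) :
    ℓ * (χ / (n / ℓ : ℕ)) ≤ (ℓ : ℝ) ^ 2 * χ / n + c₂ * χ / (n / ℓ : ℕ) := by
  have h1 : n < ℓ * (n / ℓ) + ℓ := Nat.lt_mul_div_succ n hℓ
  have h2 : ℓ * (n / ℓ) ≤ n := Nat.mul_div_le n ℓ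
  set m := n / ℓ
  have h1' : (n : ℝ) ≤ ℓ * m + ℓ := by exact_mod_cast h1.le
  have h2' : (ℓ : ℝ) * m ≤ n := by exact_mod_cast h2
  have hm' : (0 : ℝ) < m := by exact_mod_cast hm
  have hℓ' : (0 : ℝ) < ℓ := by exact_mod_cast hℓ
  have hn : (0 : ℝ) < n := lt_of_lt_of_le (by positivity) h2'
  have hc0 : 0 ≤ c₂ * m := hℓ'.le.trans hc
  rw [← sub_le_iff_le_add', show (ℓ : ℝ) * (χ / m) - (ℓ : ℝ) ^ 2 * χ / n = ℓ * χ * (n - ℓ * m) / (m * n) by field_simp,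
    div_le_div_iff₀ (by positivity) hm']
  calc ℓ * χ * (n - ℓ * m) * (m : ℝ) ≤ ℓ * χ * ℓ * m := by gcongr; linarith
    _ = ℓ * (ℓ * m) * χ := by ring
    _ ≤ c₂ * m * n * χ := by gcongr
    _ = _ := by ring

theorem one_div_block_le (hm : 0 < n / ℓ) (hℓ : 0 < ℓ) (hc₂ : 0 < c₂)
    (hc : (ℓ : ℝ) ≤ c₂ * ((n / ℓ : ℕ) : ℝ)) :
    1 / ((n / ℓ : ℕ) : ℝ) ≤ Real.sqrt (2 * c₂) / Real.sqrt n := by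
  have h1 : n < ℓ * (n / ℓ) + ℓ := Nat.lt_mul_div_succ n hℓ
  have h2 : ℓ * (n / ℓ) ≤ n := Nat.mul_div_le n ℓ
  set m := n / ℓ
  have h1' : (n : ℝ) ≤ ℓ * m + ℓ := by exact_mod_cast h1.le
  have h2' : (ℓ : ℝ) * m ≤ n := by exact_mod_cast h2
  have hm' : (1 : ℝ) ≤ m := by exact_mod_cast hm
  have hℓ' : (0 : ℝ) < ℓ := by exact_mod_cast hℓ
  have hn : (0 : ℝ) < n := lt_of_lt_of_le (by positivity) h2'
  rw [div_le_div_iff₀ (by positivity) (Real.sqrt_pos.2 hn), one_mul, Real.sqrt_le_iff]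
  refine ⟨by positivity, ?_⟩
  rw [mul_pow, Real.sq_sqrt (by positivity)]
  nlinarith [mul_le_mul_of_nonneg_left hm' hℓ'.le, mul_le_mul_of_nonneg_right hc
    (show (0 : ℝ) ≤ m by linarith)]

theorem le_sq_mul_chi_div (hm : 0 < n / ℓ) (hℓ : 0 < ℓ) (hc : c₁ * ((n / ℓ : ℕ) : ℝ) ≤ ℓ)
    (hχ : 0 ≤ χ) : c₁ * χ / 2 ≤ (ℓ : ℝ) ^ 2 * χ / n := by
  have h1 : n < ℓ * (n / ℓ) + ℓ := Nat.lt_mul_div_succ n hℓ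
  have h2 : ℓ * (n / ℓ) ≤ n := Nat.mul_div_le n ℓ
  set m := n / ℓ
  have h1' : (n : ℝ) ≤ ℓ * m + ℓ := by exact_mod_cast h1.le
  have h2' : (ℓ : ℝ) * m ≤ n := by exact_mod_cast h2
  have hm' : (1 : ℝ) ≤ m := by exact_mod_cast hm
  have hℓ' : (0 : ℝ) < ℓ := by exact_mod_cast hℓ
  have hn : (0 : ℝ) < n := lt_of_lt_of_le (by positivity) h2'
  rw [div_le_div_iff₀ two_pos hn]
  have h3 : (n : ℝ) ≤ 2 * (ℓ * m) := by nlinarith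
  have h4 : c₁ * n ≤ 2 * (ℓ : ℝ) ^ 2 := by
    rcases le_total 0 c₁ with h0 | h0
    · nlinarith [mul_le_mul_of_nonneg_left h3 h0, mul_le_mul_of_nonneg_left hc hℓ'.le]
    · nlinarith [mul_nonneg (neg_nonneg.2 h0) hn.le, sq_nonneg (ℓ : ℝ)]
  nlinarith

end Arithmetic

/-! ### Hockey-stick divergences of the PPM output -/

theorem exists_block_length_rpow_le {δ : ℝ} (hδ : 0 < δ) :
    ∃ m₀ : ℕ, ∀ m : ℕ, m₀ ≤ m → (m : ℝ) ^ (-(1 / 3) : ℝ) ≤ δ := by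
  have h := (tendsto_rpow_neg_atTop (show (0 : ℝ) < 1 / 3 by norm_num)).comp
    (tendsto_natCast_atTop_atTop (R := ℝ))
  exact eventually_atTop.1 (h.eventually_le_const hδ)

/-- The hockey-stick divergence of a PPM output from the product distribution, expressed through
the block likelihood ratios. -/
theorem sum_max_sub_ppmOutput_eq {Z : Type*} [Fintype Z] (W : DMC (Fin 2) Z) {w : Z → ℝ}
    (hw : ∀ z, W.prob 1 z = W.prob 0 z * w z) (n ℓ : ℕ) (γ : ℝ) :
    ∑ z, max (γ * prodDist (W.prob 0) n z - ppmOutput W n ℓ z) 0 =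
      ∑ y, prodDist (prodDist (W.prob 0) (n / ℓ)) ℓ y *
        max (γ - ∏ i, ((∑ j, w (y i j)) / (n / ℓ : ℕ))) 0 := by
  rw [← sum_prodDist_blocks (W.prob_sum 0) n ℓ fun y =>
    max (γ - ∏ i, ((∑ j, w (y i j)) / (n / ℓ : ℕ))) 0]
  refine Finset.sum_congr rfl fun z _ => ?_
  rw [ppmOutput_eq W hw, mul_max_of_nonneg _ _ (prodDist_nonneg (W.prob_nonneg 0) n z)]
  congr 1 <;> ring

/-- The hockey-stick divergences of a PPM output are, up to `1 / √ℓ`, at most those of a Gaussian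
shift experiment, uniformly in the threshold `exp k`.  The error is in fact `O(m ^ (-2/3))` for
blocks of length `m`. -/
theorem exists_sum_max_sub_ppmOutput_le {Z : Type*} [Fintype Z] (W : DMC (Fin 2) Z)
    (hac : AbsCont (W.prob 1) (W.prob 0)) (hac' : AbsCont (W.prob 0) (W.prob 1))
    (hχ : 0 < chiSq (W.prob 1) (W.prob 0)) {c₁ c₂ : ℝ} (hc₁ : 0 < c₁) (hc₂ : 0 < c₂) :
    ∃ m₀ : ℕ, ∀ n ℓ : ℕ, 0 < ℓ → m₀ ≤ n / ℓ →
      c₁ * ((n / ℓ : ℕ) : ℝ) ≤ ℓ → (ℓ : ℝ) ≤ c₂ * ((n / ℓ : ℕ) : ℝ) → ∀ k : ℝ,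
      ∑ z, max (Real.exp k * prodDist (W.prob 0) n z - ppmOutput W n ℓ z) 0 ≤
        bsPut k ((ℓ : ℝ) ^ 2 * chiSq (W.prob 1) (W.prob 0) / n) 1 + 1 / Real.sqrt ℓ := by
  obtain ⟨w, hw, -, -, hwa⟩ := exists_likelihoodRatio W hac
  obtain ⟨a, ha, ha1, haw⟩ := hwa hac'
  have hwsum : ∑ z, W.prob 0 z * w z = 1 := by simp_rw [← hw, W.prob_sum]
  obtain ⟨C, hC, hmom⟩ := exists_block_moments (W.prob_nonneg 0) (W.prob_sum 0) hwsum
  rw [← chiSq_eq hw] at hmom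
  set χ := chiSq (W.prob 1) (W.prob 0)
  set T := 1 + χ + c₂ * χ with hT
  have hT0 : 0 < T := by positivity
  set B := 4 * (4 + 4 * T) * (C / 6 + C / (24 * a ^ 3) + χ ^ 2 / 2) / χ with hB
  have hB0 : 0 ≤ B := by positivity
  set D := c₁ * χ / 2 with hD
  have hD0 : 0 < D := by positivity
  -- The total error is `E * ρ ^ 2`, where `ρ = m ^ (-1 / 3)` and the initial variance is
  -- `(1 + χ) * ρ ^ 2`.
  set E := B + (1 + χ + c₂ * χ) / (2 * Real.sqrt D) with hE
  have hE0 : 0 < E := by positivity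
  obtain ⟨m₁, hm₁⟩ := exists_block_length_rpow_le (show 0 < 1 / (E ^ 2 * c₂) by positivity)
  refine ⟨m₁ + 1, fun n ℓ hℓ hm hc hc' k => ?_⟩
  have hm0 : 0 < n / ℓ := by omega
  have hρ := hm₁ (n / ℓ) (by omega)
  obtain ⟨m1, m2, m3, m4⟩ := hmom (n / ℓ) hm0
  have hlow := le_sq_mul_chi_div hm0 hℓ hc hχ.le
  have hup := mul_chi_div_le hm0 hℓ hc' hχ.le
  rw [sum_max_sub_ppmOutput_eq W hw]
  have hsum := sum_prodDist (W.prob_sum 0) (n / ℓ)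
  have hnn := prodDist_nonneg (W.prob_nonneg 0) (n / ℓ)
  set m := n / ℓ
  set d2 := (ℓ : ℝ) ^ 2 * χ / n with hd2
  have hm1 : (1 : ℝ) ≤ m := by exact_mod_cast hm0
  have hmpos : (0 : ℝ) < m := by linarith
  have hℓpos : (0 : ℝ) < ℓ := by exact_mod_cast hℓ
  set ρ := (m : ℝ) ^ (-(1 / 3) : ℝ) with hρdef
  have hρ0 : 0 < ρ := Real.rpow_pos_of_pos hmpos _
  have hρ1 : ρ ≤ 1 := Real.rpow_le_one_of_one_le_of_nonpos hm1 (by norm_num)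
  have hρ3 : 1 / (m : ℝ) = ρ ^ 3 := by
    rw [hρdef, ← Real.rpow_natCast, ← Real.rpow_mul hmpos.le]
    norm_num [Real.rpow_neg_one]
  have hρ32 : ρ ^ 3 ≤ ρ ^ 2 := pow_le_pow_of_le_one hρ0.le hρ1 (by norm_num)
  have hτ : χ / (m : ℝ) = χ * ρ ^ 3 := by rw [← hρ3]; ring
  have hη : C / (m : ℝ) ^ 2 = C * (ρ ^ 3) ^ 2 := by rw [← hρ3]; ring
  set ε := (1 + χ) * ρ ^ 2 with hε
  have hε0 : 0 < ε := by positivity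
  have hτε : χ / (m : ℝ) ≤ ε := by
    rw [hτ, hε]
    have := mul_le_mul_of_nonneg_left hρ32 hχ.le
    linarith [sq_nonneg ρ]
  have hℓτ : (ℓ : ℝ) * (χ / m) ≤ c₂ * χ := by
    rw [mul_div_assoc', div_le_iff₀ hmpos]
    have := mul_le_mul_of_nonneg_right hc' hχ.le
    linarith
  have hεT : ε + ℓ * (χ / m) ≤ T := by
    have : (1 + χ) * ρ ^ 2 ≤ 1 + χ :=
      mul_le_of_le_one_right (by positivity) (pow_le_one₀ hρ0.le hρ1)
    rw [hε, hT]
    linarith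
  have hAa : ∀ y : Fin m → Z, a ≤ (∑ j, w (y j)) / m := by
    intro y
    rw [le_div_iff₀ hmpos]
    calc a * m = ∑ _j : Fin m, a := by simp [mul_comm]
      _ ≤ _ := Finset.sum_le_sum fun j _ => haw _
  have h := sum_prodDist_max_le (A := fun y : Fin m → Z => (∑ j, w (y j)) / m) hnn hsum ha ha1 hAa
    (τ := χ / m) (η := C / m ^ 2) (by positivity) (by positivity) m1 m2 m3 m4 ℓ hτε hεT k
  refine h.trans ?_
  have hBerr : 4 * (4 + 4 * T) * (C / (m : ℝ) ^ 2 / 6 + C / (m : ℝ) ^ 2 / (24 * a ^ 3) +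
      (χ / m) ^ 2 / 2) / (χ / m) * (1 / Real.sqrt ε) ≤ B * ρ ^ 2 := by
    have e : 4 * (4 + 4 * T) * (C / (m : ℝ) ^ 2 / 6 + C / (m : ℝ) ^ 2 / (24 * a ^ 3) +
      (χ / m) ^ 2 / 2) / (χ / m) = B * ρ ^ 3 := by
      rw [hη, hτ, hB]
      field_simp
    have h1 : ρ ≤ Real.sqrt ε := by
      refine Real.le_sqrt_of_sq_le ?_
      rw [hε]
      have : 0 ≤ χ * ρ ^ 2 := by positivity
      linarith
    calc _ ≤ B * ρ ^ 3 * (1 / ρ) := by rw [e]; gcongr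
      _ = B * ρ ^ 2 := by field_simp
  have hd2pos : 0 < d2 := hD0.trans_le hlow
  have hput : bsPut k (ε + ℓ * (χ / m)) 1 ≤
      bsPut k d2 1 + (1 + χ + c₂ * χ) / (2 * Real.sqrt D) * ρ ^ 2 := by
    have hle : ε + ℓ * (χ / m) ≤ d2 + (1 + χ + c₂ * χ) * ρ ^ 2 := by
      have : c₂ * χ / m = c₂ * χ * ρ ^ 3 := by rw [← hρ3]; ring
      rw [this] at hup
      have : c₂ * χ * ρ ^ 3 ≤ c₂ * χ * ρ ^ 2 := by gcongr
      rw [hε]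
      linarith
    refine (bsPut_mono_time (by positivity) hle one_pos).trans
      ((bsPut_add_time_le hd2pos (by positivity) one_pos).trans ?_)
    have : 1 / (2 * Real.sqrt d2) ≤ 1 / (2 * Real.sqrt D) := by gcongr
    have h3 : 0 ≤ (1 + χ + c₂ * χ) * ρ ^ 2 := by positivity
    have := mul_le_mul_of_nonneg_right this h3
    refine add_le_add_right (this.trans (le_of_eq ?_)) _
    ring
  have hfin : E * ρ ^ 2 ≤ 1 / Real.sqrt ℓ := by
    rw [le_div_iff₀ (Real.sqrt_pos.2 hℓpos)]
    refine (sq_le_sq₀ (by positivity) zero_le_one).1 ?_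
    rw [mul_pow, Real.sq_sqrt hℓpos.le]
    rw [le_div_iff₀ (by positivity)] at hρ
    have hmρ : (m : ℝ) * ρ ^ 3 = 1 := by rw [← hρ3]; field_simp
    calc (E * ρ ^ 2) ^ 2 * ℓ ≤ (E * ρ ^ 2) ^ 2 * (c₂ * m) := by gcongr
      _ = ρ * (E ^ 2 * c₂) * (m * ρ ^ 3) := by ring
      _ ≤ 1 ^ 2 := by rw [hmρ]; linarith
  rw [hE, add_mul] at hfin
  linarith

/-! ### Variational distance and hypothesis testing -/

theorem ppmOutput_eq_of_chiSq_eq_zero {Z : Type*} [Fintype Z] (W : DMC (Fin 2) Z)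
    (hac : AbsCont (W.prob 1) (W.prob 0)) (hχ : chiSq (W.prob 1) (W.prob 0) = 0) {n ℓ : ℕ}
    (hm : 0 < n / ℓ) : ppmOutput W n ℓ = prodDist (W.prob 0) n := by
  obtain ⟨w, hw, -, hw1, -⟩ := exists_likelihoodRatio W hac
  rw [chiSq_eq hw, Finset.sum_eq_zero_iff_of_nonneg
    fun z _ => mul_nonneg (W.prob_nonneg 0 z) (sq_nonneg _)] at hχ
  have h : ∀ z, w z = 1 := by
    intro z
    rcases mul_eq_zero.1 (hχ z (Finset.mem_univ z)) with h | h
    · exact hw1 z h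
    · exact sub_eq_zero.1 (pow_eq_zero_iff two_ne_zero |>.1 h)
  funext z
  have : ((n / ℓ : ℕ) : ℝ) ≠ 0 := by exact_mod_cast hm.ne'
  rw [ppmOutput_eq W hw]
  simp [h, div_self this]

theorem sum_ppmOutput_le_one {Z : Type*} [Fintype Z] (W : DMC (Fin 2) Z) (n ℓ : ℕ) :
    ∑ z, ppmOutput W n ℓ z ≤ 1 := by
  have h : ∀ x : Fin n → Fin 2, ∑ z : Fin n → Z, ∏ i, W.prob (x i) (z i) = 1 := by
    intro x
    have := Finset.prod_univ_sum (fun _ : Fin n => (Finset.univ : Finset Z))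
      fun i z => W.prob (x i) z
    rw [Fintype.piFinset_univ] at this
    rw [← this]
    simp [W.prob_sum]
  unfold ppmOutput
  rw [Finset.sum_comm]
  simp_rw [← Finset.mul_sum, h, mul_one]
  unfold ppmInput
  rw [Finset.sum_ite_mem, Finset.univ_inter]
  simpa using mul_inv_le_one

theorem varDist_le_sum_max {Ω : Type*} [Fintype Ω] {P Q : Ω → ℝ} (h : ∑ x, P x ≤ ∑ x, Q x) :
    varDist P Q ≤ ∑ x, max (Q x - P x) 0 := by
  have h1 : ∑ x, |P x - Q x| = 2 * ∑ x, max (Q x - P x) 0 + (∑ x, P x - ∑ x, Q x) := by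
    rw [Finset.mul_sum, ← Finset.sum_sub_distrib, ← Finset.sum_add_distrib]
    refine Finset.sum_congr rfl fun x _ => ?_
    rcases le_total (P x) (Q x) with hx | hx
    · rw [abs_of_nonpos (by linarith), max_eq_left (by linarith)]
      ring
    · rw [abs_of_nonneg (by linarith), max_eq_right (by linarith)]
      ring
  rw [varDist, h1]
  linarith

/-- The easy half of the Neyman–Pearson lemma: each hockey-stick divergence bounds the trade-off
curve from below by a line. -/
theorem le_betaErr {Ω : Type*} [Fintype Ω] [DecidableEq Ω] {α γ : ℝ} {P Q : Ω → ℝ}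
    (hα : 0 ≤ α) (hγ : 0 ≤ γ) (hP : ∑ x, P x = 1) :
    γ * (1 - α) - ∑ x, max (γ * P x - Q x) 0 ≤ betaErr α P Q := by
  refine le_csInf ⟨_, Finset.univ, by simpa using hα, rfl⟩ ?_
  rintro b ⟨T, hT, rfl⟩
  have h1 : 1 - α ≤ ∑ x ∈ T, P x := by
    have := Finset.sum_add_sum_compl T P
    linarith
  have h2 : ∑ x ∈ T, (γ * P x - Q x) ≤ ∑ x, max (γ * P x - Q x) 0 :=
    (Finset.sum_le_sum fun x _ => le_max_left _ _).trans
      (Finset.sum_le_univ_sum_of_nonneg fun x => le_max_right _ _)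
  rw [Finset.sum_sub_distrib, ← Finset.mul_sum] at h2
  have := mul_le_mul_of_nonneg_left h1 hγ
  linarith

theorem bsPut_zero_one {d : ℝ} (hd : 0 < d) : bsPut 0 (d ^ 2) 1 = 1 - 2 * gaussQ (d / 2) := by
  have h1 : bsD1 0 (d ^ 2) 1 = d / 2 := by
    rw [bsD1, Real.sqrt_sq hd.le, Real.log_one]
    field_simp
    ring
  have h2 : bsD2 0 (d ^ 2) 1 = -(d / 2) := by
    rw [bsD2, Real.sqrt_sq hd.le, Real.log_one]
    field_simp
    ring
  rw [bsPut, h1, h2, gaussQ_neg, Real.exp_zero]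
  ring

/-- The strike at which the put is exercised with probability `1 - gaussQ x`. -/
theorem bsPut_threshold {d : ℝ} (hd : 0 < d) (x : ℝ) :
    bsPut (d * x - d ^ 2 / 2) (d ^ 2) 1 =
      Real.exp (d * x - d ^ 2 / 2) * (1 - gaussQ x) - gaussQ (d - x) := by
  have h1 : bsD1 (d * x - d ^ 2 / 2) (d ^ 2) 1 = d - x := by
    rw [bsD1, Real.sqrt_sq hd.le, Real.log_one]
    field_simp
    ring
  have h2 : bsD2 (d * x - d ^ 2 / 2) (d ^ 2) 1 = -x := by
    rw [bsD2, Real.sqrt_sq hd.le, Real.log_one]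
    field_simp
    ring
  rw [bsPut, h1, h2, gaussQ_neg, one_mul]

theorem chiSq_nonneg {Ω : Type*} [Fintype Ω] {P Q : Ω → ℝ} (hQ : ∀ x, 0 ≤ Q x) : 0 ≤ chiSq P Q :=
  Finset.sum_nonneg fun x _ => div_nonneg (sq_nonneg _) (hQ x)

theorem gaussQ_zero : gaussQ 0 = 1 / 2 := by
  have := gaussQ_neg 0
  rw [neg_zero] at this
  linarith

theorem sq_mul_sqrt_div {ℓ n χ : ℝ} (hχ : 0 ≤ χ) (hn : 0 ≤ n) :
    (ℓ * Real.sqrt (χ / n)) ^ 2 = ℓ ^ 2 * χ / n := by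
  rw [mul_pow, Real.sq_sqrt (by positivity), mul_div_assoc]

end Covert

open Covert

theorem lemma8 {Z : Type*} [Fintype Z] [DecidableEq Z] (W : DMC (Fin 2) Z)
    (hac : AbsCont (W.prob 1) (W.prob 0))
    (c₁ c₂ : ℝ) (hc₁ : 0 < c₁) (hc₂ : 0 < c₂) :
    (∃ (K : ℝ) (m₀ : ℕ), ∀ n ℓ : ℕ, 0 < n → 0 < ℓ → m₀ ≤ n / ℓ →
      c₁ * ((n / ℓ : ℕ) : ℝ) ≤ (ℓ : ℝ) → (ℓ : ℝ) ≤ c₂ * ((n / ℓ : ℕ) : ℝ) →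
      relEntropy (ppmOutput W n ℓ) (prodDist (W.prob 0) n) ≤
        (ℓ : ℝ) ^ 2 / (2 * (n : ℝ)) * chiSq (W.prob 1) (W.prob 0) + K / Real.sqrt n) ∧
    (AbsCont (W.prob 0) (W.prob 1) →
      (∃ (K : ℝ) (m₀ : ℕ), ∀ n ℓ : ℕ, 0 < n → 0 < ℓ → m₀ ≤ n / ℓ →
        c₁ * ((n / ℓ : ℕ) : ℝ) ≤ (ℓ : ℝ) → (ℓ : ℝ) ≤ c₂ * ((n / ℓ : ℕ) : ℝ) →
        varDist (ppmOutput W n ℓ) (prodDist (W.prob 0) n) ≤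
          1 - 2 * gaussQ ((ℓ : ℝ) / 2 * Real.sqrt (chiSq (W.prob 1) (W.prob 0) / (n : ℝ)))
            + 2 / Real.sqrt ℓ + K / Real.sqrt n) ∧
      (∀ α : ℝ, 0 ≤ α → α < 1 →
        ∃ (K : ℝ) (m₀ : ℕ), ∀ n ℓ : ℕ, 0 < n → 0 < ℓ → m₀ ≤ n / ℓ →
          c₁ * ((n / ℓ : ℕ) : ℝ) ≤ (ℓ : ℝ) → (ℓ : ℝ) ≤ c₂ * ((n / ℓ : ℕ) : ℝ) →
          α + 1 / Real.sqrt ℓ < 1 ∧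
          gaussQ ((ℓ : ℝ) * Real.sqrt (chiSq (W.prob 1) (W.prob 0) / (n : ℝ))
              - gaussQInv (α + 1 / Real.sqrt ℓ)) - 1 / Real.sqrt ℓ - K / Real.sqrt n ≤
            betaErr α (prodDist (W.prob 0) n) (ppmOutput W n ℓ))) := by
  have hχ : 0 ≤ chiSq (W.prob 1) (W.prob 0) := chiSq_nonneg (W.prob_nonneg 0)
  refine ⟨?_, fun hac' => ⟨?_, fun α hα hα1 => ?_⟩⟩
  · obtain ⟨w, hw, hw0, -, -⟩ := exists_likelihoodRatio W hac
    obtain ⟨C, hC, hD⟩ := relEntropy_ppmOutput_le W hw hw0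
    rw [← chiSq_eq hw] at hD
    set χ := chiSq (W.prob 1) (W.prob 0)
    refine ⟨c₂ * (C + χ / 2) * Real.sqrt (2 * c₂), 1, fun n ℓ hn hℓ hm _ hc' => ?_⟩
    have h1 := hD n ℓ hm
    have h2 := mul_chi_div_le hm hℓ hc' hχ
    have h3 := one_div_block_le hm hℓ hc₂ hc'
    refine h1.trans ?_
    set m := n / ℓ
    have hmpos : (0 : ℝ) < m := by exact_mod_cast hm
    have hnpos : (0 : ℝ) < n := by exact_mod_cast hn
    have h4 : (ℓ : ℝ) * (C / (m : ℝ) ^ 2) ≤ c₂ * C * (1 / m) := by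
      calc (ℓ : ℝ) * (C / (m : ℝ) ^ 2) ≤ c₂ * m * (C / (m : ℝ) ^ 2) := by gcongr
        _ = _ := by field_simp
    have h5 : c₂ * (C + χ / 2) * (1 / (m : ℝ)) ≤
        c₂ * (C + χ / 2) * (Real.sqrt (2 * c₂) / Real.sqrt n) := by gcongr
    have e1 : (ℓ : ℝ) * (χ / (2 * m) + C / (m : ℝ) ^ 2) =
        ℓ * (χ / m) / 2 + ℓ * (C / (m : ℝ) ^ 2) := by
      field_simp
    have e2 : c₂ * χ / m = c₂ * χ * (1 / (m : ℝ)) := by ring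
    have e3 : (ℓ : ℝ) ^ 2 / (2 * (n : ℝ)) * χ = (ℓ : ℝ) ^ 2 * χ / n / 2 := by field_simp
    rw [e1, e3, mul_div_assoc (c₂ * (C + χ / 2))]
    rw [e2] at h2
    linarith
  · rcases hχ.eq_or_lt with h0 | hpos
    · refine ⟨0, 1, fun n ℓ hn hℓ hm _ _ => ?_⟩
      rw [ppmOutput_eq_of_chiSq_eq_zero W hac h0.symm hm, ← h0]
      simp only [varDist, sub_self, abs_zero, Finset.sum_const_zero, zero_div, Real.sqrt_zero,
        mul_zero, gaussQ_zero]
      have : 0 ≤ 2 / Real.sqrt ℓ := by positivity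
      linarith
    · obtain ⟨m₀, h⟩ := exists_sum_max_sub_ppmOutput_le W hac hac' hpos hc₁ hc₂
      refine ⟨0, m₀, fun n ℓ hn hℓ hm hc hc' => ?_⟩
      have hb := h n ℓ hℓ hm hc hc' 0
      have hnpos : (0 : ℝ) < n := by exact_mod_cast hn
      have hℓpos : (0 : ℝ) < ℓ := by exact_mod_cast hℓ
      have hd : 0 < (ℓ : ℝ) * Real.sqrt (chiSq (W.prob 1) (W.prob 0) / n) := by positivity
      rw [← sq_mul_sqrt_div hχ hnpos.le, bsPut_zero_one hd, Real.exp_zero] at hb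
      simp_rw [one_mul] at hb
      have hv := varDist_le_sum_max (P := ppmOutput W n ℓ) (Q := prodDist (W.prob 0) n)
        ((sum_ppmOutput_le_one W n ℓ).trans (sum_prodDist (W.prob_sum 0) n).ge)
      have h1 : 1 / Real.sqrt ℓ ≤ 2 / Real.sqrt ℓ := by gcongr; norm_num
      rw [div_mul_eq_mul_div, zero_div]
      linarith
  · -- `1 / √ℓ < 1 - α` as soon as `ℓ ≥ c₁ * m > 1 / (1 - α) ^ 2`.
    obtain ⟨m₁, hm₁⟩ := exists_nat_gt (1 / (1 - α) ^ 2 / c₁)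
    have hα' : ∀ n ℓ : ℕ, m₁ ≤ n / ℓ → c₁ * ((n / ℓ : ℕ) : ℝ) ≤ (ℓ : ℝ) →
        α + 1 / Real.sqrt ℓ < 1 := by
      intro n ℓ hm hc
      have h1 : 0 < 1 - α := by linarith
      have h2 : 1 / (1 - α) ^ 2 < ℓ := by
        rw [div_lt_iff₀ hc₁] at hm₁
        have : (m₁ : ℝ) ≤ ((n / ℓ : ℕ) : ℝ) := by exact_mod_cast hm
        nlinarith
      have h3 : 1 / (1 - α) < Real.sqrt ℓ := by
        refine Real.lt_sqrt_of_sq_lt ?_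
        rwa [div_pow, one_pow]
      have h4 := one_div_lt_one_div_of_lt (by positivity) h3
      rw [one_div_one_div] at h4
      linarith
    have hα0 : ∀ ℓ : ℕ, 0 < ℓ → 0 < α + 1 / Real.sqrt ℓ := fun ℓ hℓ => by
      have : (0 : ℝ) < ℓ := by exact_mod_cast hℓ
      positivity
    rcases hχ.eq_or_lt with h0 | hpos
    · refine ⟨0, m₁ + 1, fun n ℓ hn hℓ hm hc _ => ⟨hα' n ℓ (by omega) hc, ?_⟩⟩
      rw [ppmOutput_eq_of_chiSq_eq_zero W hac h0.symm (by omega), ← h0, zero_div, Real.sqrt_zero,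
        mul_zero, zero_sub, gaussQ_neg, gaussQ_gaussQInv (hα0 ℓ hℓ) (hα' n ℓ (by omega) hc)]
      have := le_betaErr (Q := prodDist (W.prob 0) n) hα zero_le_one
        (sum_prodDist (W.prob_sum 0) n)
      simp only [one_mul, sub_self, max_self, Finset.sum_const_zero, sub_zero] at this
      have h1 : 0 ≤ 1 / Real.sqrt ℓ := by positivity
      rw [zero_div]
      linarith
    · obtain ⟨m₀, h⟩ := exists_sum_max_sub_ppmOutput_le W hac hac' hpos hc₁ hc₂
      refine ⟨0, m₀ + m₁, fun n ℓ hn hℓ hm hc hc' => ⟨hα' n ℓ (by omega) hc, ?_⟩⟩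
      have hnpos : (0 : ℝ) < n := by exact_mod_cast hn
      have hℓpos : (0 : ℝ) < ℓ := by exact_mod_cast hℓ
      have hd : 0 < (ℓ : ℝ) * Real.sqrt (chiSq (W.prob 1) (W.prob 0) / n) := by positivity
      set d := (ℓ : ℝ) * Real.sqrt (chiSq (W.prob 1) (W.prob 0) / n) with hd_def
      set x := gaussQInv (α + 1 / Real.sqrt ℓ)
      -- The likelihood-ratio threshold that is optimal for the Gaussian problem at this level.
      have hb := h n ℓ hℓ (by omega) hc hc' (d * x - d ^ 2 / 2)
      rw [← sq_mul_sqrt_div hχ hnpos.le, ← hd_def, bsPut_threshold hd,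
        gaussQ_gaussQInv (hα0 ℓ hℓ) (hα' n ℓ (by omega) hc)] at hb
      have hβ := le_betaErr (Q := ppmOutput W n ℓ) hα (Real.exp_pos (d * x - d ^ 2 / 2)).le
        (sum_prodDist (W.prob_sum 0) n)
      have h1 : 0 ≤ Real.exp (d * x - d ^ 2 / 2) * (1 / Real.sqrt ℓ) := by positivity
      rw [zero_div]
      nlinarith
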